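/- **Setting.** Let $k$ be a commutative Noetherian ring and let $\mathcal C$ be a small category such that: (i) all sets $\mathcal C(x,y)$ are finite; (ii) the relation "$x\leqslant y$ iff $\mathcal C(x,y)\neq\emptyset$" is a partial order on the objects; (iii) there is a rank function $|\cdot|:\operatorname{Ob}\mathcal C\to\mathbb N$ with $|x|\leqslant|y|$ whenever $x\leqslant y$ and $|y|=|x|+1$ whenever $y$ covers $x$; (iv) for every $n\in\mathbb N$ only finitely many objects have rank $n$ (a *locally finite, locally bounded graded category*). A *$\mathcal C$-module* is a functor $V:\mathcal C\to k\text{-}\mathrm{Mod}$, with values $V_x$; the *free module* at $x$ is $M(x)=k\mathcal C(x,-)$. $V$ is *finitely generated* if some finite set of elements of $\bigoplus_x V_x$ lies in no proper submodule, and $\mathcal C$ is *locally Noetherian over $k$* if submodules of finitely generated $\mathcal C$-modules are finitely generated. The *generating degree* $\operatorname{gd}(V)$ is the infimum of the $n\in\mathbb N$ such that no proper submodule of $V$ contains $\bigoplus_{|x|\leqslant n}V_x$ (so $\operatorname{gd}(V)=\infty$ if there is no such $n$), and $\operatorname{gd}(0)=-1$. An *inductive functor of multiplicity $d$* ($d$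 a positive integer) is an exact functor $F:\mathcal C\text{-}\mathrm{Mod}\to\mathcal C\text{-}\mathrm{Mod}$ with a natural transformation $\theta:\mathrm{Id}^{\oplus d}\to F$ such that for every object $x$ the module $FM(x)$ is finitely generated and $\theta_{M(x)}:M(x)^{\oplus d}\to FM(x)$ is injective, and such that $\operatorname{gd}(\operatorname{coker}\theta_V)=\operatorname{gd}(V)-1$ for every nonzero $\mathcal C$-module $V$. Let $k\mathcal C$ be the category algebra and $\mathfrak m=\bigoplus_{x<y}k\mathcal C(x,y)$, a two-sided ideal. For a $\mathcal C$-module $V$ and $i\geqslant0$ put $H_i(V)=\operatorname{Tor}_i^{k\mathcal C}(k\mathcal C/\mathfrak m,V)$, the $i$-th left derived functor of $k\mathcal C/\mathfrak m\otimes_{k\mathcal C}-$, which is again a $\mathcal C$-module. Let $\operatorname{hd}_i(V)=\sup\{|x| : H_i(V)_x\neq0\}$ if $H_i(V)\neq0$ and $\operatorname{hd}_i(V)=-1$ otherwise, and let the Castelnuovo–Mumford regularity be $\operatorname{reg}(V)=\sup\{\operatorname{hd}_i(V)-i : i\geqslant0\}\in\mathbb Z\cup\{\infty\}$. **Theorem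 1.2.** Let $\mathcal C$ be a locally finite, locally bounded graded category equipped with an inductive functor $F$ of multiplicity $d$, and let $k$ be a commutative Noetherian ring such that $\mathcal C$ is locally Noetherian over $k$. If $\operatorname{reg}(FM(x))\leqslant|x|$ for every object $x$ of $\mathcal C$, then $\operatorname{reg}(V)<\infty$ for every finitely generated $\mathcal C$-module $V$. -/

import Mathlib

open CategoryTheory CategoryTheory.Limits
open scoped TensorProduct DirectSum

universe u

/-- `x < y` in the order on objects for which `x ≤ y` means that there is a morphism `x ⟶ y`. -/
def ObjLT {C : Type u} [SmallCategory C] (x y : C) : Prop :=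
  x ≠ y ∧ Nonempty (x ⟶ y)

/-- `y` covers `x`: `x < y` and there is no object strictly between them. -/
def ObjCovers {C : Type u} [SmallCategory C] (x y : C) : Prop :=
  ObjLT x y ∧ ∀ z : C, ObjLT x z → ¬ ObjLT z y

/-- A locally finite, locally bounded graded category.  The relation `Nonempty (x ⟶ y)` is always
reflexive and transitive, so `directed` says precisely that it is a partial ordering. -/
class GradedCategory (C : Type u) [SmallCategory C] where
  /-- the rank function `x ↦ |x|` -/
  rank : C → ℕ
  locallyFinite : ∀ x y : C, Finite (x ⟶ y)
  directed : ∀ x y : C, Nonempty (x ⟶ y) → Nonempty (y ⟶ x) → x = y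
  rank_mono : ∀ x y : C, Nonempty (x ⟶ y) → rank x ≤ rank y
  rank_covers : ∀ x y : C, ObjCovers x y → rank y = rank x + 1
  locallyBounded : ∀ n : ℕ, {x : C | rank x = n}.Finite

namespace GradedCategory

noncomputable section

variable (k : Type u) [CommRing k] (C : Type u) [SmallCategory C]

/-- `C`-modules: covariant functors from `C` to `k`-modules. -/
abbrev CMod : Type (u + 1) := C ⥤ ModuleCat.{u} k

variable {C}

/-- The free module `M(x) = kC(x, -)`. -/
def freeMod (x : C) : CMod k C :=
  coyoneda.obj (Opposite.op x) ⋙ ModuleCat.free k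

variable {k}

/-- `V` is finitely generated: some finite set of (homogeneous) elements of `V` is contained in no
proper submodule; a submodule is given by a monomorphism into `V`. -/
def IsFG (V : CMod k C) : Prop :=
  ∃ S : Set (Σ x : C, V.obj x), S.Finite ∧
    ∀ (W : CMod k C) (i : W ⟶ V) [Mono i],
      (∀ s ∈ S, ∃ w : W.obj s.1, (i.app s.1).hom w = s.2) → IsIso i

variable (k C) in
/-- `C` is locally Noetherian over `k`: submodules of finitely generated modules are finitely
generated. -/
def LocallyNoetherian : Prop :=
  ∀ (V : CMod k C), IsFG V → ∀ (W : CMod k C) (i : W ⟶ V) [Mono i], IsFG W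

/-- The category of `C`-modules has enough projectives. -/
instance : EnoughProjectives (CMod k C) where
  presentation V := by
    let L (x : C) : CMod k C :=
      (evaluationLeftAdjoint (ModuleCat.{u} k) x).obj (Projective.over (V.obj x))
    let φ (x : C) : L x ⟶ V :=
      ((evaluationAdjunctionRight (ModuleCat.{u} k) x).homEquiv _ V).symm (Projective.π (V.obj x))
    have hL (x : C) : Projective (L x) :=
      (evaluationAdjunctionRight (ModuleCat.{u} k) x).map_projective _ inferInstance
    have hφ (x : C) : Epi ((φ x).app x) := by
      have h : (evaluationAdjunctionRight (ModuleCat.{u} k) x).homEquiv _ V (φ x) =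
          Projective.π (V.obj x) := Equiv.apply_symm_apply _ _
      rw [Adjunction.homEquiv_unit] at h
      have h' : Epi ((evaluationAdjunctionRight (ModuleCat.{u} k) x).unit.app _ ≫ (φ x).app x) := by
        change Epi (_ ≫ ((evaluation C (ModuleCat.{u} k)).obj x).map (φ x))
        rw [h]
        exact Projective.π_epi _
      exact epi_of_epi ((evaluationAdjunctionRight (ModuleCat.{u} k) x).unit.app _) _
    have (x : C) : Epi ((Sigma.desc φ).app x) := by
      have h : (Sigma.ι L x).app x ≫ (Sigma.desc φ).app x = (φ x).app x := by
        rw [← NatTrans.comp_app, Sigma.ι_desc]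
      have h' : Epi ((Sigma.ι L x).app x ≫ (Sigma.desc φ).app x) := by
        rw [h]
        exact hφ x
      exact epi_of_epi ((Sigma.ι L x).app x) _
    have hepi : Epi (Sigma.desc φ) := NatTrans.epi_of_epi_app _
    exact ⟨{ p := ∐ L, f := Sigma.desc φ }⟩

section Degree

variable [GradedCategory C]

/-- `V` is generated in degrees `≤ n`: no proper submodule contains `V_x` for all `|x| ≤ n`. -/
def GeneratedInDegrees (V : CMod k C) (n : ℕ) : Prop :=
  ∀ (W : CMod k C) (i : W ⟶ V) [Mono i],
    (∀ x : C, rank x ≤ n → Function.Surjective (i.app x).hom) → IsIso i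

open Classical in
/-- The generating degree; it is `-1` for the zero module, and `⊤` if `V` is not generated in
degrees `≤ n` for any `n`. -/
def gd (V : CMod k C) : EReal :=
  if IsZero V then -1 else ⨅ (n : ℕ) (_ : GeneratedInDegrees V n), (n : EReal)

end Degree

section InductiveFunctor

instance : HasFiniteBiproducts (CMod k C) := Abelian.hasFiniteBiproducts

variable (k C) in
/-- The functor `Id^{⊕ d}`. -/
def idCopies (d : ℕ) : CMod k C ⥤ CMod k C where
  obj V := ⨁ fun _ : Fin d => V
  map f := biproduct.map fun _ => f

variable (k C) in
/-- An inductive functor of multiplicity `d`. -/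
structure InductiveFunctor [GradedCategory C] (d : ℕ) where
  F : CMod k C ⥤ CMod k C
  preservesFiniteLimits : PreservesFiniteLimits F
  preservesFiniteColimits : PreservesFiniteColimits F
  d_pos : 0 < d
  θ : idCopies k C d ⟶ F
  isFG_free : ∀ x : C, IsFG (F.obj (freeMod k x))
  mono_free : ∀ x : C, Mono (θ.app (freeMod k x))
  gd_cokernel : ∀ V : CMod k C, ¬ IsZero V → gd (cokernel (θ.app V)) = gd V - 1

end InductiveFunctor

/-! ### The category algebra modulo the ideal `m`

The category algebra is `kC = ⨁ kC(y, x)`, and the two-sided ideal `m` is spanned by the morphisms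
`y ⟶ x` with `y < x`.  Everything is written componentwise. -/

section Quotient

variable (k) in
/-- The component `m(y, x)` of the ideal `m` in `kC(y, x)`. -/
def ideal (y x : C) : Submodule k ((y ⟶ x) →₀ k) :=
  Submodule.span k {a | ObjLT y x ∧ ∃ f : y ⟶ x, a = Finsupp.single f 1}

variable (k) in
/-- The component of `kC / m` at `(y, x)`. -/
def AlgQuot (y x : C) : Type u := ((y ⟶ x) →₀ k) ⧸ ideal k y x

instance (y x : C) : AddCommGroup (AlgQuot k y x) :=
  inferInstanceAs (AddCommGroup (((y ⟶ x) →₀ k) ⧸ ideal k y x))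

instance (y x : C) : Module k (AlgQuot k y x) :=
  inferInstanceAs (Module k (((y ⟶ x) →₀ k) ⧸ ideal k y x))

variable (k) in
/-- The projection `kC(y, x) → (kC / m)(y, x)`. -/
def algMk (y x : C) : ((y ⟶ x) →₀ k) →ₗ[k] AlgQuot k y x := (ideal k y x).mkQ

theorem algQuot_ext {y x : C} {N : Type u} [AddCommGroup N] [Module k N]
    {φ ψ : AlgQuot k y x →ₗ[k] N}
    (h : ∀ f : y ⟶ x, φ (algMk k y x (Finsupp.single f 1)) = ψ (algMk k y x (Finsupp.single f 1))) :
    φ = ψ :=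
  Submodule.linearMap_qext (ideal k y x)
    (Finsupp.lhom_ext' fun f => LinearMap.ext_ring (h f))

variable [GradedCategory C]

theorem ideal_le_left (y : C) {x x' : C} (g : x ⟶ x') :
    ideal k y x ≤ (ideal k y x').comap (Finsupp.lmapDomain k k fun f : y ⟶ x => f ≫ g) := by
  refine Submodule.span_le.2 ?_
  rintro _ ⟨⟨hne, hf⟩, f, rfl⟩
  refine Submodule.subset_span ⟨⟨?_, ⟨f ≫ g⟩⟩, f ≫ g, by simp⟩
  rintro rfl
  exact hne (directed _ _ ⟨f⟩ ⟨g⟩)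

theorem ideal_le_right {y y' : C} (g : y' ⟶ y) (x : C) :
    ideal k y x ≤ (ideal k y' x).comap (Finsupp.lmapDomain k k fun f : y ⟶ x => g ≫ f) := by
  refine Submodule.span_le.2 ?_
  rintro _ ⟨⟨hne, hf⟩, f, rfl⟩
  refine Submodule.subset_span ⟨⟨?_, ⟨g ≫ f⟩⟩, g ≫ f, by simp⟩
  rintro rfl
  exact hne (directed _ _ ⟨f⟩ ⟨g⟩)

variable (k) in
/-- The left action of a morphism `g` of `C` on `kC / m`. -/
def quotLeft (y : C) {x x' : C} (g : x ⟶ x') : AlgQuot k y x →ₗ[k] AlgQuot k y x' :=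
  Submodule.mapQ (ideal k y x) (ideal k y x') _ (ideal_le_left y g)

variable (k) in
/-- The right action of a morphism `g` of `C` on `kC / m`. -/
def quotRight {y y' : C} (g : y' ⟶ y) (x : C) : AlgQuot k y x →ₗ[k] AlgQuot k y' x :=
  Submodule.mapQ (ideal k y x) (ideal k y' x) _ (ideal_le_right g x)

theorem quotLeft_mk (y : C) {x x' : C} (g : x ⟶ x') (f : y ⟶ x) :
    quotLeft k y g (algMk k y x (Finsupp.single f 1)) =
      algMk k y x' (Finsupp.single (f ≫ g) 1) :=
  congrArg (algMk k y x') (Finsupp.mapDomain_single (f := fun f : y ⟶ x => f ≫ g))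

theorem quotRight_mk {y y' : C} (g : y' ⟶ y) (x : C) (f : y ⟶ x) :
    quotRight k g x (algMk k y x (Finsupp.single f 1)) =
      algMk k y' x (Finsupp.single (g ≫ f) 1) :=
  congrArg (algMk k y' x) (Finsupp.mapDomain_single (f := fun f : y ⟶ x => g ≫ f))

theorem quotLeft_id (y x : C) : quotLeft k y (𝟙 x) = LinearMap.id := by
  refine algQuot_ext fun f => ?_
  simp [quotLeft_mk]

theorem quotLeft_comp (y : C) {x x' x'' : C} (g : x ⟶ x') (g' : x' ⟶ x'') :
    quotLeft k y (g ≫ g') = quotLeft k y g' ∘ₗ quotLeft k y g := by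
  refine algQuot_ext fun f => ?_
  simp [quotLeft_mk]

theorem quotLeft_quotRight {y y' x x' : C} (f : y' ⟶ y) (g : x ⟶ x') (q : AlgQuot k y x) :
    quotLeft k y' g (quotRight k f x q) = quotRight k f x' (quotLeft k y g q) := by
  suffices quotLeft k y' g ∘ₗ quotRight k f x = quotRight k f x' ∘ₗ quotLeft k y g from
    LinearMap.congr_fun this q
  refine algQuot_ext fun h => ?_
  simp [quotLeft_mk, quotRight_mk]

end Quotient

/-! ### The functor `kC / m ⊗_{kC} -` and its left derived functors -/

section Homology

variable [GradedCategory C]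

/-- The `k`-module `(kC / m)(y, x) ⊗_k V_y`. -/
abbrev Summand (V : CMod k C) (y x : C) : Type u := AlgQuot k y x ⊗[k] V.obj y

open Classical in
/-- The relations `q f ⊗ v = q ⊗ f v` (for `f` a morphism of `C`) that define the tensor product
over `kC`, in the part of the tensor product over `k` lying over the object `x`. -/
def tensorRel (V : CMod k C) (x : C) : Submodule k (⨁ y : C, Summand V y x) :=
  Submodule.span k {t | ∃ (y' y : C) (f : y' ⟶ y) (q : AlgQuot k y x) (v : V.obj y'),
    t = DirectSum.lof k C (fun y => Summand V y x) y' (quotRight k f x q ⊗ₜ[k] v) -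
      DirectSum.lof k C (fun y => Summand V y x) y (q ⊗ₜ[k] (V.map f).hom v)}

/-- The value of `kC / m ⊗_{kC} V` at `x`. -/
abbrev TensorAt (V : CMod k C) (x : C) : Type u :=
  (⨁ y : C, Summand V y x) ⧸ tensorRel V x

theorem tensorRel_le_left (V : CMod k C) {x x' : C} (g : x ⟶ x') :
    tensorRel V x ≤ (tensorRel V x').comap
      (DirectSum.lmap (M := fun y => Summand V y x) (N := fun y => Summand V y x')
        fun y => (quotLeft k y g).rTensor (V.obj y)) := by
  classical
  refine Submodule.span_le.2 ?_
  rintro _ ⟨y', y, f, q, v, rfl⟩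
  refine Submodule.subset_span ⟨y', y, f, quotLeft k y g q, v, ?_⟩
  simp [DirectSum.lmap_lof, quotLeft_quotRight]

theorem tensorRel_le_map {V W : CMod k C} (η : V ⟶ W) (x : C) :
    tensorRel V x ≤ (tensorRel W x).comap
      (DirectSum.lmap (M := fun y => Summand V y x) (N := fun y => Summand W y x)
        fun y => (η.app y).hom.lTensor (AlgQuot k y x)) := by
  classical
  refine Submodule.span_le.2 ?_
  rintro _ ⟨y', y, f, q, v, rfl⟩
  refine Submodule.subset_span ⟨y', y, f, q, (η.app y').hom v, ?_⟩
  have h : (η.app y).hom ((V.map f).hom v) = (W.map f).hom ((η.app y').hom v) :=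
    NatTrans.naturality_apply η f v
  simp [DirectSum.lmap_lof, h]

/-- The left action of a morphism of `C` on `kC / m ⊗_{kC} V`. -/
def tensorLeft (V : CMod k C) {x x' : C} (g : x ⟶ x') : TensorAt V x →ₗ[k] TensorAt V x' :=
  Submodule.mapQ _ _ _ (tensorRel_le_left V g)

/-- The map `kC / m ⊗_{kC} V → kC / m ⊗_{kC} W` induced by `η : V ⟶ W`, at the object `x`. -/
def tensorMap {V W : CMod k C} (η : V ⟶ W) (x : C) : TensorAt V x →ₗ[k] TensorAt W x :=
  Submodule.mapQ _ _ _ (tensorRel_le_map η x)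

open Classical in
theorem tensorAt_ext {V : CMod k C} {x : C} {N : Type u} [AddCommGroup N] [Module k N]
    {φ ψ : TensorAt V x →ₗ[k] N}
    (h : ∀ (y : C) (q : AlgQuot k y x) (v : V.obj y),
      φ (Submodule.Quotient.mk (DirectSum.lof k C (fun y => Summand V y x) y
        (q ⊗ₜ[k] v))) =
      ψ (Submodule.Quotient.mk (DirectSum.lof k C (fun y => Summand V y x) y
        (q ⊗ₜ[k] v)))) : φ = ψ :=
  Submodule.linearMap_qext _ (DirectSum.linearMap_ext k fun y => TensorProduct.ext' fun q v =>
    h y q v)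

open Classical in
theorem tensorLeft_mk (V : CMod k C) {x x' : C} (g : x ⟶ x') (y : C) (q : AlgQuot k y x)
    (v : V.obj y) :
    tensorLeft V g (Submodule.Quotient.mk (DirectSum.lof k C (fun y => Summand V y x) y
        (q ⊗ₜ[k] v))) =
      Submodule.Quotient.mk (DirectSum.lof k C (fun y => Summand V y x') y
        (quotLeft k y g q ⊗ₜ[k] v)) := by
  simp [tensorLeft, DirectSum.lmap_lof]

open Classical in
theorem tensorMap_mk {V W : CMod k C} (η : V ⟶ W) {x : C} (y : C) (q : AlgQuot k y x)
    (v : V.obj y) :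
    tensorMap η x (Submodule.Quotient.mk (DirectSum.lof k C (fun y => Summand V y x) y
        (q ⊗ₜ[k] v))) =
      Submodule.Quotient.mk (DirectSum.lof k C (fun y => Summand W y x) y
        (q ⊗ₜ[k] (η.app y).hom v)) := by
  simp [tensorMap, DirectSum.lmap_lof]

theorem tensorLeft_id (V : CMod k C) (x : C) : tensorLeft V (𝟙 x) = LinearMap.id :=
  tensorAt_ext fun y q v => by simp [tensorLeft_mk, quotLeft_id]

theorem tensorLeft_comp (V : CMod k C) {x x' x'' : C} (g : x ⟶ x') (g' : x' ⟶ x'') :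
    tensorLeft V (g ≫ g') = tensorLeft V g' ∘ₗ tensorLeft V g :=
  tensorAt_ext fun y q v => by simp [tensorLeft_mk, quotLeft_comp]

theorem tensorMap_id (V : CMod k C) (x : C) : tensorMap (𝟙 V) x = LinearMap.id :=
  tensorAt_ext fun y q v => by simp [tensorMap_mk]

theorem tensorMap_comp {U V W : CMod k C} (η : U ⟶ V) (η' : V ⟶ W) (x : C) :
    tensorMap (η ≫ η') x = tensorMap η' x ∘ₗ tensorMap η x :=
  tensorAt_ext fun y q v => by simp [tensorMap_mk]

theorem tensorMap_add {V W : CMod k C} (η η' : V ⟶ W) (x : C) :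
    tensorMap (η + η') x = tensorMap η x + tensorMap η' x :=
  tensorAt_ext fun y q v => by simp [tensorMap_mk, TensorProduct.tmul_add]

theorem tensorMap_tensorLeft {V W : CMod k C} (η : V ⟶ W) {x x' : C} (g : x ⟶ x') :
    tensorMap η x' ∘ₗ tensorLeft V g = tensorLeft W g ∘ₗ tensorMap η x :=
  tensorAt_ext fun y q v => by simp [tensorMap_mk, tensorLeft_mk]

/-- The `C`-module `kC / m ⊗_{kC} V`. -/
def tensorObj (V : CMod k C) : CMod k C where
  obj x := ModuleCat.of k (TensorAt V x)
  map g := ModuleCat.ofHom (tensorLeft V g)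
  map_id x := ModuleCat.hom_ext (tensorLeft_id V x)
  map_comp g g' := ModuleCat.hom_ext (tensorLeft_comp V g g')

variable (k C) in
/-- The functor `kC / m ⊗_{kC} -` on `C`-modules. -/
def tensorFunctor : CMod k C ⥤ CMod k C where
  obj V := tensorObj V
  map η :=
    { app := fun x => ModuleCat.ofHom (tensorMap η x)
      naturality := fun _ _ g => ModuleCat.hom_ext (tensorMap_tensorLeft η g) }
  map_id V := NatTrans.ext (funext fun x => ModuleCat.hom_ext (tensorMap_id V x))
  map_comp η η' := NatTrans.ext (funext fun x => ModuleCat.hom_ext (tensorMap_comp η η' x))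

instance : (tensorFunctor k C).Additive where
  map_add {_ _ η η'} := NatTrans.ext (funext fun x => ModuleCat.hom_ext (tensorMap_add η η' x))

/-- The homology `H_i(V) = Tor_i^{kC}(kC / m, V)`. -/
def homology (i : ℕ) (V : CMod k C) : CMod k C :=
  ((tensorFunctor k C).leftDerived i).obj V

open Classical in
/-- The `i`-th homological degree. -/
def hd (i : ℕ) (V : CMod k C) : EReal :=
  if IsZero (homology i V) then -1
  else ⨆ (x : C) (_ : ¬ IsZero ((homology i V).obj x)), (rank x : EReal)

/-- The Castelnuovo–Mumford regularity. -/
def reg (V : CMod k C) : EReal :=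
  ⨆ i : ℕ, hd i V - (i : EReal)

end Homology

end

end GradedCategory

/-!
Write `reg V < c` as the vanishing of `Ext^i(V, S)` for all `i` and all `S` that are zero in ranks
`< c + i`. Take a maximal sequence of components of `θ` that is regular on `V`, and let `Q V` be
the quotient of `F V` by it. Such a sequence is regular on the finite sums of free modules too, and
hence on the syzygies of `V`. As `V` is generated in degrees at most one higher than `Q V`, a bound
for `Q V` then yields one for `V`, by taking syzygies repeatedly. By maximality, no component of `θ`
is injective on `V` modulo the sequence, so `Q V` is built by extensions from proper quotients of
`V` and a quotient of the cokernel of `θ`. The former are covered by Noetherian induction, the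
latter, which is generated in smaller degrees than `V`, by induction on the generating degree.
-/

namespace GradedCategory

open scoped ZeroObject

noncomputable section

section RegularSequence

variable {A : Type*} [Category* A]

theorem sum_single_comp [Preadditive A] {ι : Type*} [Fintype ι] [DecidableEq ι] {X Y Z : A} (i : ι)
    (f : X ⟶ Y) (g : ι → (Y ⟶ Z)) : ∑ j, (Pi.single i f : ι → (X ⟶ Y)) j ≫ g j = f ≫ g i := by
  rw [Finset.sum_eq_single_of_mem i (Finset.mem_univ i), Pi.single_eq_same]
  intro j _ hj
  rw [Pi.single_eq_of_ne hj, zero_comp]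

variable [Abelian A]

theorem shortExact_of_isColimit_cokernelCofork {S T : ShortComplex A} {φ : S ⟶ T}
    (hS : S.ShortExact) (hT : T.ShortExact) (hφ : Mono φ.τ₃) {c : CokernelCofork φ}
    (hc : IsColimit c) : c.pt.ShortExact := by
  let D : ShortComplex.SnakeInput A :=
    { L₀ := kernel φ
      L₁ := S
      L₂ := T
      L₃ := c.pt
      v₀₁ := kernel.ι φ
      v₁₂ := φ
      v₂₃ := c.π
      w₀₂ := kernel.condition φ
      w₁₃ := c.condition
      h₀ := kernelIsKernel φ
      h₃ := hc.ofIsoColimit (isoOfπ c)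
      L₁_exact := hS.exact
      epi_L₁_g := hS.epi_g
      L₂_exact := hT.exact
      mono_L₂_f := hT.mono_f }
  have hδ : D.δ = 0 := by
    have : Mono D.v₀₁.τ₃ := (ShortComplex.π₃ (C := A)).map_mono (kernel.ι φ)
    have h₀ : D.v₀₁.τ₃ = 0 := by
      rw [← cancel_mono φ.τ₃, zero_comp]
      exact D.w₀₂_τ₃
    exact (IsZero.of_mono_eq_zero D.v₀₁.τ₃ h₀).eq_of_src _ _
  have : Epi c.π := epi_of_isColimit_cofork hc
  have := hT.epi_g
  have : Epi c.π.τ₃ := (ShortComplex.π₃ (C := A)).map_epi c.π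
  have : Epi (c.π.τ₂ ≫ c.pt.g) := by
    rw [c.π.comm₂₃]
    infer_instance
  exact
    { exact := D.L₃_exact
      mono_f := D.L₂'_exact.mono_g hδ
      epi_g := epi_of_epi c.π.τ₂ _ }

theorem preservesZeroMorphisms_of_epi {F G : A ⥤ A} [F.PreservesZeroMorphisms] (α : F ⟶ G)
    [Epi α] : G.PreservesZeroMorphisms where
  map_zero X Y := by
    rw [← cancel_epi (α.app X), ← α.naturality, F.map_zero, zero_comp, comp_zero]

instance {F G : A ⥤ A} [G.PreservesZeroMorphisms] (α : F ⟶ G) :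
    (cokernel α).PreservesZeroMorphisms :=
  preservesZeroMorphisms_of_epi (cokernel.π α)

/-- Cokernels in the category of endofunctors are computed objectwise. -/
def isColimitCokernelApp {F G : A ⥤ A} (α : F ⟶ G) (V : A) :
    IsColimit (CokernelCofork.ofπ (f := α.app V) ((cokernel.π α).app V)
      (congr_app (cokernel.condition α) V)) :=
  CokernelCofork.mapIsColimit _ (cokernelIsCokernel α) ((evaluation A A).obj V)

theorem shortExact_map_cokernel {F G : A ⥤ A} [F.PreservesZeroMorphisms]
    [G.PreservesZeroMorphisms] (α : F ⟶ G) {S : ShortComplex A} (hF : (S.map F).ShortExact)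
    (hG : (S.map G).ShortExact) (hα : Mono (α.app S.X₃)) :
    (S.map (cokernel α)).ShortExact := by
  let c : CokernelCofork (S.mapNatTrans α) :=
    CokernelCofork.ofπ (S.mapNatTrans (cokernel.π α)) (by
      ext <;> exact congr_app (cokernel.condition α) _)
  have hc : IsColimit c := ShortComplex.isColimitOfIsColimitπ _
    ((c.isColimitMapCoconeEquiv ShortComplex.π₁).symm (isColimitCokernelApp α S.X₁))
    ((c.isColimitMapCoconeEquiv ShortComplex.π₂).symm (isColimitCokernelApp α S.X₂))
    ((c.isColimitMapCoconeEquiv ShortComplex.π₃).symm (isColimitCokernelApp α S.X₃))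
  exact shortExact_of_isColimit_cokernelCofork hF hG hα hc

theorem shortExact_app_cokernel {F G : A ⥤ A} (α : F ⟶ G) (V : A) [Mono (α.app V)] :
    (ShortComplex.mk (α.app V) ((cokernel.π α).app V)
      (congr_app (cokernel.condition α) V)).ShortExact where
  exact := ShortComplex.exact_of_g_is_cokernel _ (isColimitCokernelApp α V)
  mono_f := ‹_›
  epi_g := inferInstanceAs (Epi ((cokernel.π α).app V))

variable {F : A ⥤ A} {ι : Type} (θ : ι → (𝟭 A ⟶ F))

/-- The quotient `F / (θ i₁, …, θ iₙ)` together with the projection from `F`, obtained by killing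
one transformation after the other, beginning at the end of the list. -/
def iteratedQuotient : List ι → Under F
  | [] => Under.mk (𝟙 F)
  | i :: l => Under.mk ((iteratedQuotient l).hom ≫ cokernel.π (θ i ≫ (iteratedQuotient l).hom))

/-- The quotient functor `F / (θ i₁, …, θ iₙ)`. -/
abbrev quotientBy (l : List ι) : A ⥤ A := (iteratedQuotient θ l).right

/-- The projection `F ⟶ F / (θ i₁, …, θ iₙ)`. -/
abbrev quotientByπ (l : List ι) : F ⟶ quotientBy θ l := (iteratedQuotient θ l).hom

/-- The transformation `Id ⟶ F / (θ i₁, …, θ iₙ)` induced by `θ i`. -/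
abbrev induced (l : List ι) (i : ι) : 𝟭 A ⟶ quotientBy θ l := θ i ≫ quotientByπ θ l

/-- The transformations in a list, taken from its end, form a regular sequence on `V`: each `θ i`
is injective on `V` modulo the preceding ones. -/
def IsRegularOn (V : A) : List ι → Prop
  | [] => True
  | i :: l => IsRegularOn V l ∧ Mono ((induced θ l i).app V)

variable {θ}

instance epi_quotientByπ (l : List ι) : Epi (quotientByπ θ l) := by
  induction l with
  | nil => exact inferInstanceAs (Epi (𝟙 F))
  | cons i l ih => exact epi_comp (quotientByπ θ l) (cokernel.π (induced θ l i))

instance [F.PreservesZeroMorphisms] (l : List ι) : (quotientBy θ l).PreservesZeroMorphisms :=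
  preservesZeroMorphisms_of_epi (quotientByπ θ l)

variable (θ) in
theorem induced_cons (l : List ι) (i j : ι) :
    induced θ (i :: l) j = induced θ l j ≫ cokernel.π (induced θ l i) :=
  (Category.assoc _ _ _).symm

variable (θ) in
theorem induced_cons_app (l : List ι) (i j : ι) (V : A) :
    (induced θ (i :: l) j).app V =
      (induced θ l j).app V ≫ (cokernel.π (induced θ l i)).app V :=
  congr_app (induced_cons θ l i j) V

theorem induced_eq_zero {l : List ι} {i : ι} (hi : i ∈ l) : induced θ l i = 0 := by
  induction l with
  | nil => simp at hi
  | cons j l ih =>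
    rw [induced_cons]
    obtain rfl | hi := List.mem_cons.1 hi
    · exact cokernel.condition _
    · rw [ih hi]
      exact zero_comp

theorem exists_quotientByπ_app_comp {V R : A} (q : F.obj V ⟶ R) (l : List ι)
    (hq : ∀ i ∈ l, (θ i).app V ≫ q = 0) :
    ∃ r : (quotientBy θ l).obj V ⟶ R, (quotientByπ θ l).app V ≫ r = q := by
  induction l with
  | nil => exact ⟨q, Category.id_comp q⟩
  | cons i l ih =>
    obtain ⟨r, hr⟩ := ih fun j hj => hq j (List.mem_cons_of_mem i hj)
    have h : (induced θ l i).app V ≫ r = 0 := by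
      rw [NatTrans.comp_app, Category.assoc, hr, hq i List.mem_cons_self]
    obtain ⟨t, ht⟩ := CokernelCofork.IsColimit.desc' (isColimitCokernelApp (induced θ l i) V) r h
    refine ⟨t, ?_⟩
    exact (Category.assoc ..).trans ((congrArg ((quotientByπ θ l).app V ≫ ·) ht).trans hr)

namespace IsRegularOn

theorem of_isZero {V : A} (hV : IsZero V) (l : List ι) : IsRegularOn θ V l := by
  induction l with
  | nil => trivial
  | cons i l ih => exact ⟨ih, hV.mono _⟩

theorem of_mono {V W : A} (f : V ⟶ W) [Mono f] {l : List ι} (hW : IsRegularOn θ W l) :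
    IsRegularOn θ V l := by
  induction l with
  | nil => trivial
  | cons i l ih =>
    have := hW.2
    have h : (induced θ l i).app V ≫ (quotientBy θ l).map f = f ≫ (induced θ l i).app W :=
      ((induced θ l i).naturality f).symm
    exact ⟨ih hW.1, mono_of_mono_fac h⟩

theorem shortExact_map [PreservesFiniteLimits F] [PreservesFiniteColimits F] {S : ShortComplex A}
    (hS : S.ShortExact) {l : List ι} (h : IsRegularOn θ S.X₃ l) :
    (S.map (quotientBy θ l)).ShortExact := by
  induction l with
  | nil => exact hS.map_of_exact F
  | cons i l ih => exact shortExact_map_cokernel _ hS (ih h.1) h.2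

theorem of_shortExact [PreservesFiniteLimits F] [PreservesFiniteColimits F] {S : ShortComplex A}
    (hS : S.ShortExact) {l : List ι} (h₁ : IsRegularOn θ S.X₁ l) (h₃ : IsRegularOn θ S.X₃ l) :
    IsRegularOn θ S.X₂ l := by
  induction l with
  | nil => trivial
  | cons i l ih =>
    have := h₁.2
    have := h₃.2
    exact ⟨ih h₁.1 h₃.1, ShortComplex.mono_of_mono_of_mono_of_mono
      (φ := S.mapNatTrans (induced θ l i)) hS.exact (h₃.1.shortExact_map hS).mono_f ‹_› ‹_›⟩

theorem nodup {V : A} (hV : ¬ IsZero V) {l : List ι} (h : IsRegularOn θ V l) : l.Nodup := by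
  induction l with
  | nil => exact List.nodup_nil
  | cons i l ih =>
    refine List.nodup_cons.2 ⟨fun hi => hV ?_, ih h.1⟩
    have := h.2
    exact IsZero.of_mono_eq_zero ((induced θ l i).app V) (by rw [induced_eq_zero hi]; rfl)

theorem exists_forall_not_mono {V : A} (hV : ¬ IsZero V) (s : Finset ι) :
    ∃ l, IsRegularOn θ V l ∧ ∀ i ∈ s, ¬ Mono ((induced θ l i).app V) := by
  classical
  induction s using Finset.induction_on with
  | empty => exact ⟨[], trivial, by simp⟩
  | insert i s _ ih =>
    obtain ⟨l, hl, hs⟩ := ih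
    by_cases hi : Mono ((induced θ l i).app V)
    · refine ⟨i :: l, ⟨hl, hi⟩,
        (Finset.forall_mem_insert _ _ _).2 ⟨fun h => hV ?_, fun j hj h => hs j hj ?_⟩⟩
      · exact IsZero.of_mono_eq_zero ((induced θ (i :: l) i).app V)
          (by rw [induced_eq_zero List.mem_cons_self]; rfl)
      · rw [induced_cons_app] at h
        exact @mono_of_mono _ _ _ _ _ _ _ h
    · exact ⟨l, hl, (Finset.forall_mem_insert _ _ _).2 ⟨hi, hs⟩⟩

theorem shortExact_induced {V : A} {i : ι} {l : List ι} (h : IsRegularOn θ V (i :: l)) :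
    (ShortComplex.mk ((induced θ l i).app V) ((cokernel.π (induced θ l i)).app V)
      (congr_app (cokernel.condition (induced θ l i)) V)).ShortExact :=
  have := h.2
  shortExact_app_cokernel _ V

theorem of_mono_desc [Finite ι] {V : A} [HasBiproduct fun _ : ι => V]
    [Mono (biproduct.desc (f := fun _ : ι => V) fun i => (θ i).app V)]
    {l : List ι} (hl : l.Nodup) : IsRegularOn θ V l := by
  classical
  have := Fintype.ofFinite ι
  suffices h : IsRegularOn θ V l ∧ ∀ (T : A) (v : ι → (T ⟶ V)),
      ∑ j, v j ≫ (induced θ l j).app V = 0 → ∀ j ∉ l, v j = 0 from h.1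
  induction l with
  | nil =>
    refine ⟨trivial, fun T v hv j _ => ?_⟩
    have h : biproduct.lift v ≫
        biproduct.desc (f := fun _ : ι => V) (fun i => (θ i).app V) = 0 := by
      refine (biproduct.lift_desc (f := fun _ : ι => V)).trans (Eq.trans ?_ hv)
      exact Finset.sum_congr rfl fun j _ => congrArg (v j ≫ ·) (Category.comp_id _).symm
    rw [← biproduct.lift_π v j, zero_of_comp_mono _ h, zero_comp]
  | cons i l ih =>
    obtain ⟨hi, hl⟩ := List.nodup_cons.1 hl
    obtain ⟨hreg, hind⟩ := ih hl
    have hreg' : IsRegularOn θ V (i :: l) := by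
      refine ⟨hreg, Preadditive.mono_of_cancel_zero _ fun {T} f hf => ?_⟩
      have := hind T (Pi.single i f) ?_ i hi
      · simpa using this
      · rw [sum_single_comp, hf]
    refine ⟨hreg', fun T v hv j hj => ?_⟩
    obtain ⟨hji, hjl⟩ := not_or.1 (List.mem_cons.not.1 hj)
    have hw : (∑ j, v j ≫ (induced θ l j).app V) ≫ (cokernel.π (induced θ l i)).app V = 0 := by
      refine (Preadditive.sum_comp ..).trans (Eq.trans ?_ hv)
      exact Finset.sum_congr rfl fun j _ =>
        (Category.assoc ..).trans (congrArg (v j ≫ ·) (induced_cons_app θ l i j V).symm)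
    have := hreg'.2
    obtain ⟨w, hw⟩ : ∃ w, w ≫ (induced θ l i).app V = ∑ j, v j ≫ (induced θ l j).app V :=
      ⟨hreg'.shortExact_induced.exact.lift _ hw, hreg'.shortExact_induced.exact.lift_f _ hw⟩
    have := hind T (v - Pi.single i w) ?_ j hjl
    · simpa [hji] using this
    · simp only [Pi.sub_apply, Preadditive.sub_comp, Finset.sum_sub_distrib, sum_single_comp, hw,
        sub_self]

end IsRegularOn

/- Divide `B` by the images of the `f i` one after the other: each image is a quotient of `V` by a
nonzero subobject, since `f i` does not become injective in a quotient of `B`. -/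
theorem prop_of_forall_not_mono {𝒬 : ObjectProperty A} [𝒬.IsClosedUnderExtensions] {V : A}
    (hV : ∀ (U : A) (e : V ⟶ U) [Epi e], ¬ Mono e → 𝒬 U) (s : Finset ι) {B : A}
    (f : ι → (V ⟶ B)) (hf : ∀ i ∈ s, ¬ Mono (f i))
    (hB : ∀ (R : A) (q : B ⟶ R) [Epi q], (∀ i ∈ s, f i ≫ q = 0) → 𝒬 R) : 𝒬 B := by
  classical
  induction s using Finset.induction_on generalizing B with
  | empty => exact hB B (𝟙 B) (by simp)
  | insert i s _ ih =>
    simp only [Finset.forall_mem_insert] at hf hB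
    have image_shortExact : (ShortComplex.mk (Abelian.image.ι (f i)) (cokernel.π (f i))
        (Abelian.image_ι_comp_eq_zero (cokernel.condition (f i)))).ShortExact :=
      { exact := (ShortComplex.exact_iff_exact_image_ι _).1 (ShortComplex.exact_cokernel (f i)) }
    refine 𝒬.prop_X₂_of_shortExact image_shortExact
      (hV _ (Abelian.factorThruImage (f i)) fun _ => hf.1 ?_)
      (ih (fun j => f j ≫ cokernel.π (f i))
        (fun j hj _ => hf.2 j hj (mono_of_mono (f j) (cokernel.π (f i)))) fun R q _ h => ?_)
    · rw [← Abelian.image.fac (f i)]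
      exact mono_comp _ _
    · refine hB R (cokernel.π (f i) ≫ q) ⟨cokernel.condition_assoc _ _ |>.trans zero_comp,
        fun j hj => ?_⟩
      rw [← Category.assoc, h j hj]

end RegularSequence

section Modules

variable {k : Type u} [CommRing k] {C : Type u} [SmallCategory C] {V W : CMod k C}

theorem mono_iff_injective (f : V ⟶ W) : Mono f ↔ ∀ x, Function.Injective (f.app x).hom := by
  rw [NatTrans.mono_iff_mono_app]
  exact forall_congr' fun x => ModuleCat.mono_iff_injective _

theorem epi_iff_surjective (f : V ⟶ W) : Epi f ↔ ∀ x, Function.Surjective (f.app x).hom := by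
  rw [NatTrans.epi_iff_epi_app]
  exact forall_congr' fun x => ModuleCat.epi_iff_surjective _

theorem app_map_apply (f : V ⟶ W) {x y : C} (g : x ⟶ y) (v : V.obj x) :
    (f.app y).hom ((V.map g).hom v) = (W.map g).hom ((f.app x).hom v) :=
  NatTrans.naturality_apply f g v

theorem hom_eq_zero_iff (f : V ⟶ W) : f = 0 ↔ ∀ x (v : V.obj x), (f.app x).hom v = 0 := by
  refine ⟨?_, fun h => ?_⟩
  · rintro rfl x v
    rfl
  · ext x v
    exact h x v

theorem cokernel_π_app_eq_zero_iff (f : V ⟶ W) {x : C} (w : W.obj x) :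
    ((cokernel.π f).app x).hom w = 0 ↔ ∃ v, (f.app x).hom v = w := by
  refine ⟨fun hw => ?_, ?_⟩
  · exact (ShortComplex.moduleCat_exact_iff _).1
      ((ShortComplex.exact_cokernel f).map ((evaluation C (ModuleCat.{u} k)).obj x)) w hw
  · rintro ⟨v, rfl⟩
    exact (hom_eq_zero_iff _).1 (cokernel.condition f) x v

theorem isZero_cokernel_obj_of_surjective (f : V ⟶ W) {x : C}
    (h : Function.Surjective (f.app x).hom) : IsZero ((cokernel f).obj x) := by
  rw [ModuleCat.isZero_iff_subsingleton]
  refine subsingleton_of_forall_eq 0 fun c => ?_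
  obtain ⟨w, rfl⟩ := (epi_iff_surjective (cokernel.π f)).1 inferInstance x c
  exact (cokernel_π_app_eq_zero_iff f w).2 (h w)

variable (V) in
/-- A submodule of `V`, given by its components. -/
@[ext]
structure SubMod where
  carrier : ∀ x, Submodule k (V.obj x)
  map_mem : ∀ {x y : C} (g : x ⟶ y) (v : V.obj x), v ∈ carrier x → (V.map g).hom v ∈ carrier y

namespace SubMod

instance : PartialOrder (SubMod V) :=
  PartialOrder.lift carrier fun _ _ h => SubMod.ext h

variable (N : SubMod V)

/-- A submodule as a `C`-module. -/
def toMod : CMod k C where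
  obj x := ModuleCat.of k (N.carrier x)
  map g := ModuleCat.ofHom ((V.map g).hom.restrict fun v hv => N.map_mem g v hv)
  map_id x := by
    ext v
    change (V.map (𝟙 x)).hom v.1 = v.1
    rw [V.map_id, ModuleCat.id_apply]
  map_comp g h := by
    ext v
    change (V.map (g ≫ h)).hom v.1 = (V.map h).hom ((V.map g).hom v.1)
    rw [V.map_comp, ModuleCat.comp_apply]

/-- The inclusion of a submodule. -/
def ι : N.toMod ⟶ V where
  app x := ModuleCat.ofHom (N.carrier x).subtype

instance : Mono N.ι := (mono_iff_injective _).2 fun _ => Subtype.val_injective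

theorem cokernel_π_ι_app_eq_zero_iff {x : C} (v : V.obj x) :
    ((cokernel.π N.ι).app x).hom v = 0 ↔ v ∈ N.carrier x :=
  (cokernel_π_app_eq_zero_iff N.ι v).trans ⟨fun ⟨w, hw⟩ => hw ▸ w.2, fun hv => ⟨⟨v, hv⟩, rfl⟩⟩

/-- The kernel of a morphism, as a submodule of its source. -/
def ker (f : V ⟶ W) : SubMod V where
  carrier x := LinearMap.ker (f.app x).hom
  map_mem g v hv := by
    rw [LinearMap.mem_ker] at hv ⊢
    rw [app_map_apply, hv, map_zero]

theorem ker_ι_comp (f : V ⟶ W) : (ker f).ι ≫ f = 0 :=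
  (hom_eq_zero_iff _).2 fun _ v => v.2

theorem ker_lt_ker_comp {U : CMod k C} (f : V ⟶ W) [Epi f] {e : W ⟶ U} (he : ¬ Mono e) :
    ker f < ker (f ≫ e) := by
  refine lt_of_le_not_ge (fun x v hv => ?_) fun h => he ?_
  · exact (congrArg (e.app x).hom (LinearMap.mem_ker.1 hv)).trans (map_zero _)
  · refine (mono_iff_injective e).2 fun x => (injective_iff_map_eq_zero _).2 fun w hw => ?_
    obtain ⟨v, rfl⟩ := (epi_iff_surjective f).1 inferInstance x w
    exact h x hw

end SubMod

theorem isFG_iff : IsFG V ↔ ∃ S : Set (Σ x : C, V.obj x), S.Finite ∧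
    ∀ (W : CMod k C) (f : V ⟶ W), (∀ s ∈ S, (f.app s.1).hom s.2 = 0) → f = 0 := by
  refine exists_congr fun S => and_congr_right fun _ => ⟨fun h W f hf => ?_, fun h W i _ hi => ?_⟩
  · have := h _ (SubMod.ker f).ι fun s hs => ⟨⟨s.2, hf s hs⟩, rfl⟩
    rw [← cancel_epi (SubMod.ker f).ι, comp_zero, SubMod.ker_ι_comp]
  · have h0 : cokernel.π i = 0 :=
      h _ _ fun s hs => (cokernel_π_app_eq_zero_iff i s.2).2 (hi s hs)
    have : Epi i := Preadditive.epi_of_cokernel_zero h0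
    exact isIso_of_mono_of_epi i

namespace IsFG

theorem of_epi (hV : IsFG V) (f : V ⟶ W) [Epi f] : IsFG W := by
  rw [isFG_iff] at hV ⊢
  obtain ⟨S, hS, h⟩ := hV
  refine ⟨(fun s => ⟨s.1, (f.app s.1).hom s.2⟩) '' S, hS.image _, fun U g hg => ?_⟩
  rw [← cancel_epi f, comp_zero]
  exact h _ _ fun s hs => hg _ ⟨s, hs, rfl⟩

theorem of_shortExact {S : ShortComplex (CMod k C)} (hS : S.ShortExact) (h₁ : IsFG S.X₁)
    (h₃ : IsFG S.X₃) : IsFG S.X₂ := by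
  rw [isFG_iff] at h₁ h₃ ⊢
  obtain ⟨A, hA, h₁⟩ := h₁
  obtain ⟨B, hB, h₃⟩ := h₃
  have := hS.epi_g
  choose l hl using (epi_iff_surjective S.g).1 inferInstance
  refine ⟨(fun s => ⟨s.1, (S.f.app s.1).hom s.2⟩) '' A ∪ (fun s => ⟨s.1, l s.1 s.2⟩) '' B,
    (hA.image _).union (hB.image _), fun U g hg => ?_⟩
  obtain ⟨g', rfl⟩ : ∃ g' : S.X₃ ⟶ U, S.g ≫ g' = g :=
    have hf : S.f ≫ g = 0 := h₁ _ _ fun s hs => hg _ (Or.inl ⟨s, hs, rfl⟩)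
    ⟨hS.exact.desc g hf, hS.exact.g_desc g hf⟩
  have hg' : g' = 0 := h₃ _ _ fun s hs => by
    rw [← hl s.1 s.2]
    exact hg _ (Or.inr ⟨s, hs, rfl⟩)
  rw [hg', comp_zero]

theorem of_isZero (h : IsZero V) : IsFG V :=
  isFG_iff.2 ⟨∅, Set.finite_empty, fun _ _ _ => h.eq_of_src _ _⟩

theorem wellFoundedGT_subMod (hN : LocallyNoetherian k C) (hV : IsFG V) :
    WellFoundedGT (SubMod V) := by
  rw [wellFoundedGT_iff_monotone_chain_condition]
  intro a
  have mem_iSup {x : C} {v : V.obj x} :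
      v ∈ ⨆ n, (a n).carrier x ↔ ∃ n, v ∈ (a n).carrier x :=
    Submodule.mem_iSup_of_directed _ (directed_of_isDirected_le fun _ _ h => a.monotone h x)
  let U : SubMod V :=
    { carrier := fun x => ⨆ n, (a n).carrier x
      map_mem := fun g v hv => by
        obtain ⟨n, hn⟩ := mem_iSup.1 hv
        exact mem_iSup.2 ⟨n, (a n).map_mem g v hn⟩ }
  obtain ⟨S, hS, h⟩ := isFG_iff.1 (hN V hV U.toMod U.ι)
  choose m hm using fun s : Σ x : C, U.toMod.obj x => mem_iSup.1 s.2.2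
  obtain ⟨n, hn⟩ := (hS.image m).bddAbove
  have h0 : U.ι ≫ cokernel.π (a n).ι = 0 := h _ _ fun s hs =>
    ((a n).cokernel_π_ι_app_eq_zero_iff _).2 (a.monotone (hn ⟨s, hs, rfl⟩) _ (hm s))
  refine ⟨n, fun j hj => le_antisymm (a.monotone hj) fun x v hv => ?_⟩
  exact ((a n).cokernel_π_ι_app_eq_zero_iff v).1
    ((hom_eq_zero_iff _).1 h0 x ⟨v, mem_iSup.2 ⟨j, hv⟩⟩)

theorem induction_on_quotients (hN : LocallyNoetherian k C) {𝒬 : CMod k C → Prop}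
    (step : ∀ W, IsFG W → (∀ (U : CMod k C) (e : W ⟶ U) [Epi e], ¬ Mono e → 𝒬 U) → 𝒬 W)
    (hV : IsFG V) : 𝒬 V := by
  have := hV.wellFoundedGT_subMod hN
  suffices h : ∀ (N : SubMod V) (W : CMod k C) (f : V ⟶ W) [Epi f], SubMod.ker f = N → 𝒬 W from
    h _ V (𝟙 V) rfl
  intro N
  induction N using WellFoundedGT.induction with
  | ind N ih =>
    rintro W f _ rfl
    exact step W (hV.of_epi f) fun U e _ he =>
      ih _ (SubMod.ker_lt_ker_comp f he) U (f ≫ e) rfl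

end IsFG

variable (k) in
/-- The generator of the free module `M(x)`. -/
def freeGen (x : C) : (freeMod k x).obj x := ModuleCat.freeMk (𝟙 x)

theorem freeMod_map_freeGen {x y : C} (f : x ⟶ y) :
    ((freeMod k x).map f).hom (freeGen k x) = ModuleCat.freeMk f :=
  (ModuleCat.free_map_apply _ _).trans (congrArg ModuleCat.freeMk (Category.id_comp f))

theorem freeMod_hom_ext {x : C} {f g : freeMod k x ⟶ V}
    (h : (f.app x).hom (freeGen k x) = (g.app x).hom (freeGen k x)) : f = g := by
  refine NatTrans.ext (funext fun y => ModuleCat.free_hom_ext fun a => ?_)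
  change (f.app y).hom _ = (g.app y).hom _
  rw [← freeMod_map_freeGen (k := k) a, app_map_apply, app_map_apply, h]

/-- The morphism `M(x) ⟶ V` determined by an element of `V_x`. -/
def freeLift {x : C} (v : V.obj x) : freeMod k x ⟶ V where
  app y := ModuleCat.freeDesc (↾fun f : x ⟶ y => (V.map f).hom v)
  naturality y z g := by
    refine ModuleCat.free_hom_ext fun a => ?_
    change (ModuleCat.freeDesc _).hom (((ModuleCat.free k).map _).hom (ModuleCat.freeMk a)) =
      (V.map g).hom ((ModuleCat.freeDesc _).hom (ModuleCat.freeMk a))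
    erw [ModuleCat.free_map_apply, ModuleCat.freeDesc_apply, ModuleCat.freeDesc_apply]
    exact congr($(V.map_comp a g).hom v)

theorem freeLift_freeGen {x : C} (v : V.obj x) :
    ((freeLift v).app x).hom (freeGen k x) = v :=
  (ModuleCat.freeDesc_apply _ _).trans congr($(V.map_id x).hom v)

instance (x : C) : Projective (freeMod k x) where
  factors f e _ := by
    obtain ⟨v, hv⟩ := (epi_iff_surjective e).1 inferInstance x ((f.app x).hom (freeGen k x))
    refine ⟨freeLift v, freeMod_hom_ext ?_⟩
    rw [← hv]
    exact congrArg (e.app x).hom (freeLift_freeGen v)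

theorem isFG_freeMod (x : C) : IsFG (freeMod k x) :=
  isFG_iff.2 ⟨{⟨x, freeGen k x⟩}, Set.finite_singleton _, fun _ _ hf => freeMod_hom_ext (hf _ rfl)⟩

end Modules

section Generation

variable {k : Type u} [CommRing k] {C : Type u} [SmallCategory C] [GradedCategory C]
  {V W : CMod k C} {n : ℕ}

/-- `S` vanishes at all objects of rank `< n`. -/
def VanishLT (S : CMod k C) (n : ℕ) : Prop := ∀ x, rank x < n → IsZero (S.obj x)

theorem VanishLT.mono {S : CMod k C} {m : ℕ} (h : VanishLT S n) (hmn : m ≤ n) : VanishLT S m :=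
  fun x hx => h x (hx.trans_le hmn)

theorem VanishLT.eq_zero {S : CMod k C} (h : VanishLT S n) {x : C} (hx : rank x < n)
    (v : S.obj x) : v = 0 :=
  (ModuleCat.isZero_iff_subsingleton.1 (h x hx)).elim _ _

/-- `V` is generated by its components of rank `< n`, expressed by the morphisms out of `V`. -/
def GenLT (V : CMod k C) (n : ℕ) : Prop := ∀ S, VanishLT S n → ∀ f : V ⟶ S, f = 0

namespace GenLT

theorem mono {m : ℕ} (h : GenLT V m) (hmn : m ≤ n) : GenLT V n :=
  fun S hS => h S (hS.mono hmn)

theorem of_epi (h : GenLT V n) (f : V ⟶ W) [Epi f] : GenLT W n := by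
  intro S hS g
  rw [← cancel_epi f, comp_zero]
  exact h S hS _

theorem of_isZero (h : IsZero V) (n : ℕ) : GenLT V n := fun _ _ _ => h.eq_of_src _ _

theorem of_shortExact {S : ShortComplex (CMod k C)} (hS : S.ShortExact) (h₁ : GenLT S.X₁ n)
    (h₃ : GenLT S.X₃ n) : GenLT S.X₂ n := by
  intro U hU g
  have := hS.epi_g
  have hf : S.f ≫ g = 0 := h₁ U hU _
  rw [← hS.exact.g_desc g hf, h₃ U hU (hS.exact.desc g hf), comp_zero]

theorem isZero_of_vanishLT (h : GenLT V n) (hV : VanishLT V n) : IsZero V :=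
  (IsZero.iff_id_eq_zero V).2 (h V hV _)

theorem epi (h : GenLT V n) (f : W ⟶ V)
    (hf : ∀ x, rank x < n → Function.Surjective (f.app x).hom) : Epi f :=
  Preadditive.epi_of_cokernel_zero
    (h _ (fun x hx => isZero_cokernel_obj_of_surjective f (hf x hx)) (cokernel.π f))

end GenLT

theorem genLT_freeMod {x : C} (hx : rank x < n) : GenLT (freeMod k x) n :=
  fun _ hS _ => freeMod_hom_ext (hS.eq_zero hx _)

theorem genLT_succ_iff : GenLT V (n + 1) ↔ GeneratedInDegrees V n := by
  constructor
  · intro h W i _ hi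
    have := h.epi i fun x hx => hi x (Nat.lt_succ_iff.1 hx)
    exact isIso_of_mono_of_epi i
  · intro h S hS f
    have := h _ (SubMod.ker f).ι fun x hx v =>
      ⟨⟨v, hS.eq_zero (Nat.lt_succ_iff.2 hx) _⟩, rfl⟩
    rw [← cancel_epi (SubMod.ker f).ι, comp_zero, SubMod.ker_ι_comp]

theorem gd_lt_natCast_iff : gd V < n ↔ GenLT V n := by
  by_cases hV : IsZero V
  · rw [gd, if_pos hV]
    have h : (-1 : EReal) < n := (by norm_num : (-1 : EReal) < 0).trans_le (by simp)
    exact iff_of_true h (.of_isZero hV n)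
  rw [gd, if_neg hV]
  simp only [iInf_lt_iff, exists_prop]
  constructor
  · rintro ⟨m, hm, hmn⟩
    exact (genLT_succ_iff.2 hm).mono (EReal.natCast_lt_iff.1 hmn)
  · intro h
    cases n with
    | zero => exact absurd (h.isZero_of_vanishLT fun _ hx => absurd hx (Nat.not_lt_zero _)) hV
    | succ m => exact ⟨m, genLT_succ_iff.1 h, EReal.natCast_lt_iff.2 m.lt_succ_self⟩

theorem IsFG.exists_genLT (hV : IsFG V) : ∃ n, GenLT V n := by
  obtain ⟨S, hS, h⟩ := isFG_iff.1 hV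
  obtain ⟨n, hn⟩ := (hS.image fun s => rank s.1).bddAbove
  exact ⟨n + 1, fun U hU f => h U f fun s hs =>
    hU.eq_zero (Nat.lt_succ_iff.2 (hn ⟨s, hs, rfl⟩)) _⟩

theorem exists_projectivePresentation (V : CMod k C) :
    ∃ p : ProjectivePresentation V, ∀ n, GenLT V n → GenLT p.p n := by
  classical
  by_cases h : ∃ n, GenLT V n
  · let L (s : {s : Σ x : C, V.obj x // rank s.1 < Nat.find h}) : CMod k C := freeMod k s.1.1
    let φ (s) : L s ⟶ V := freeLift s.1.2
    have hφ : Epi (Sigma.desc φ) := (Nat.find_spec h).epi _ fun x hx v => by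
      refine ⟨((Sigma.ι L ⟨⟨x, v⟩, hx⟩).app x).hom (freeGen k x), Eq.trans ?_ (freeLift_freeGen v)⟩
      exact congr(($(Sigma.ι_desc φ ⟨⟨x, v⟩, hx⟩).app x).hom (freeGen k x))
    have hp (s) : Projective (L s) := inferInstanceAs (Projective (freeMod k _))
    refine ⟨{ p := ∐ L, f := Sigma.desc φ }, fun n hn => GenLT.mono ?_ (Nat.find_min' h hn)⟩
    intro S hS f
    refine Sigma.hom_ext _ _ fun s => ?_
    rw [comp_zero]
    exact genLT_freeMod s.2 S hS _
  · exact ⟨(EnoughProjectives.presentation V).some, fun n hn => absurd ⟨n, hn⟩ h⟩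

theorem shortExact_biprod {A : Type*} [Category* A] [Abelian A] (X Y : A) :
    (ShortComplex.mk (biprod.inl : X ⟶ X ⊞ Y) biprod.snd biprod.inl_snd).ShortExact :=
  (ShortComplex.Splitting.ofHasBinaryBiproduct X Y).shortExact

/-- Finite direct sums of modules `M(x)` with `|x| < n`. -/
inductive IsFinFree (n : ℕ) : CMod k C → Prop
  | zero : IsFinFree n 0
  | add {P : CMod k C} (x : C) : rank x < n → IsFinFree n P → IsFinFree n (P ⊞ freeMod k x)

namespace IsFinFree

variable {P : CMod k C}

theorem projective (h : IsFinFree n P) : Projective P := by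
  induction h with
  | zero => exact (isZero_zero _).projective
  | add x _ _ ih => infer_instance

theorem isFG (h : IsFinFree n P) : IsFG P := by
  induction h with
  | zero => exact .of_isZero (isZero_zero _)
  | add x _ _ ih => exact .of_shortExact (shortExact_biprod _ _) ih (isFG_freeMod x)

theorem genLT (h : IsFinFree n P) : GenLT P n := by
  induction h with
  | zero => exact .of_isZero (isZero_zero _) n
  | add x hx _ ih => exact .of_shortExact (shortExact_biprod _ _) ih (genLT_freeMod hx)

end IsFinFree

theorem IsFG.exists_isFinFree (hN : LocallyNoetherian k C) (hV : IsFG V) (h : GenLT V n) :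
    ∃ (P : CMod k C) (f : P ⟶ V), IsFinFree n P ∧ Epi f := by
  refine hV.induction_on_quotients hN (𝒬 := fun V => GenLT V n →
    ∃ (P : CMod k C) (f : P ⟶ V), IsFinFree n P ∧ Epi f) (fun W _ ih h => ?_) h
  by_cases hW : VanishLT W n
  · have hW₀ := h.isZero_of_vanishLT hW
    exact ⟨0, 0, .zero, ⟨fun _ _ _ => hW₀.eq_of_src _ _⟩⟩
  obtain ⟨x, hx, hWx⟩ : ∃ x, rank x < n ∧ ¬ IsZero (W.obj x) := by
    simpa only [VanishLT, not_forall, exists_prop] using hW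
  rw [ModuleCat.isZero_iff_subsingleton, not_subsingleton_iff_nontrivial] at hWx
  obtain ⟨v, hv⟩ := exists_ne (0 : W.obj x)
  have hmono : ¬ Mono (cokernel.π (freeLift v)) := fun _ => hv <| by
    rw [← freeLift_freeGen v, zero_of_comp_mono _ (cokernel.condition (freeLift v))]
    rfl
  obtain ⟨P, f, hP, _⟩ := ih _ (cokernel.π (freeLift v)) hmono (h.of_epi (cokernel.π _))
  have := hP.projective
  let g : P ⟶ W := Projective.factorThru f (cokernel.π (freeLift v))
  have hg : g ≫ cokernel.π (freeLift v) = f := Projective.factorThru_comp _ _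
  refine ⟨_, biprod.desc g (freeLift v), hP.add x hx, Preadditive.epi_of_cancel_zero _ ?_⟩
  intro U t ht
  have hgt : g ≫ t = 0 := by rw [← biprod.inl_desc g (freeLift v), Category.assoc, ht, comp_zero]
  have hvt : freeLift v ≫ t = 0 := by
    rw [← biprod.inr_desc g (freeLift v), Category.assoc, ht, comp_zero]
  rw [← cokernel.π_desc _ t hvt] at hgt ⊢
  rw [← Category.assoc, hg] at hgt
  rw [zero_of_epi_comp f hgt, comp_zero]

end Generation

section Ext

open Abelian

theorem ext_succ_eq_zero {A : Type*} [Category* A] [Abelian A] [HasExt.{u} A] {S : ShortComplex A}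
    (hS : S.ShortExact) {U : A} {i : ℕ} (h₁ : ∀ e : Ext S.X₁ U i, e = 0)
    (h₂ : ∀ e : Ext S.X₂ U (i + 1), e = 0) (e : Ext S.X₃ U (i + 1)) : e = 0 := by
  obtain ⟨e', rfl⟩ := Ext.contravariant_sequence_exact₃ hS U e (h₂ _) (add_comm 1 i)
  rw [h₁ e', Ext.comp_zero]

variable {k : Type u} [CommRing k] {C : Type u} [SmallCategory C]

instance : HasExt.{u} (CMod k C) := hasExt_of_enoughProjectives _

variable [GradedCategory C]

/-- `Ext^i(V, S) = 0` for all `i` and all `S` that vanish at the objects of rank `< c + i`. This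
is the form in which the proof uses `reg V < c`. -/
def ExtVanish (V : CMod k C) (c : ℕ) : Prop :=
  ∀ (i : ℕ) (S : CMod k C), VanishLT S (c + i) → ∀ e : Ext V S i, e = 0

variable {V : CMod k C} {c : ℕ}

theorem GenLT.ext_zero_eq_zero (h : GenLT V c) {S : CMod k C} (hS : VanishLT S c)
    (e : Ext V S 0) : e = 0 :=
  Ext.addEquiv₀.injective (by rw [map_zero]; exact h S hS _)

namespace ExtVanish

theorem mono {c' : ℕ} (h : ExtVanish V c) (hc : c ≤ c') : ExtVanish V c' :=
  fun i S hS => h i S (hS.mono (by omega))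

theorem genLT (h : ExtVanish V c) : GenLT V c := fun S hS f =>
  Ext.addEquiv₀.symm.injective (by rw [map_zero]; exact h 0 S hS _)

theorem of_projective [Projective V] (h : GenLT V c) : ExtVanish V c := by
  rintro (_ | i) S hS e
  · exact h.ext_zero_eq_zero hS e
  · exact Ext.eq_zero_of_projective e

theorem of_isZero (h : IsZero V) (c : ℕ) : ExtVanish V c :=
  have := h.projective
  .of_projective (.of_isZero h c)

variable {S : ShortComplex (CMod k C)}

theorem middle (hS : S.ShortExact) (h₁ : ExtVanish S.X₁ c) (h₃ : ExtVanish S.X₃ c) :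
    ExtVanish S.X₂ c := by
  intro i U hU e
  obtain ⟨e', rfl⟩ := Ext.contravariant_sequence_exact₂ hS U e (h₁ i U hU _)
  rw [h₃ i U hU e', Ext.comp_zero]

theorem left (hS : S.ShortExact) (h₂ : ExtVanish S.X₂ (c + 1)) (h₃ : ExtVanish S.X₃ c) :
    ExtVanish S.X₁ (c + 1) := by
  intro i U hU e
  obtain ⟨e', rfl⟩ := Ext.contravariant_sequence_exact₁ hS U e (add_comm 1 i)
    (h₃ (i + 1) U (hU.mono (by omega)) _)
  rw [h₂ i U hU e', Ext.comp_zero]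

theorem right (hS : S.ShortExact) (h₁ : ExtVanish S.X₁ c) (h₂ : ExtVanish S.X₂ c) :
    ExtVanish S.X₃ c := by
  have := hS.epi_g
  rintro (_ | i) U hU e
  · exact (h₂.genLT.of_epi S.g).ext_zero_eq_zero hU e
  · exact ext_succ_eq_zero hS (h₁ i U (hU.mono (by omega))) (h₂ (i + 1) U hU) e

instance : ObjectProperty.IsClosedUnderExtensions fun V : CMod k C => ∃ c, ExtVanish V c where
  prop_X₂_of_shortExact hS := fun ⟨a, ha⟩ ⟨b, hb⟩ =>
    ⟨max a b, middle hS (ha.mono (le_max_left a b)) (hb.mono (le_max_right a b))⟩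

end ExtVanish

end Ext

section Resolution

variable {A : Type*} [Category* A] [Abelian A] (p : ∀ X : A, ProjectivePresentation X) (X : A)

/-- The iterated syzygies of `X` for the projective covers `p`. -/
def syzygy : ℕ → A
  | 0 => X
  | n + 1 => kernel (p (syzygy n)).f

/-- The terms of the resolution of `X` by the projective covers `p`. -/
abbrev resTerm (n : ℕ) : A := (p (syzygy p X n)).p

/-- The projection of a term of the resolution to the syzygy. -/
def resπ (n : ℕ) : resTerm p X n ⟶ syzygy p X n := (p (syzygy p X n)).f

/-- The inclusion of a syzygy into a term of the resolution. -/
def resι (n : ℕ) : syzygy p X (n + 1) ⟶ resTerm p X n := kernel.ι (p (syzygy p X n)).f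

instance (n : ℕ) : Epi (resπ p X n) := (p (syzygy p X n)).epi

theorem resι_resπ (n : ℕ) : resι p X n ≫ resπ p X n = 0 := kernel.condition _

theorem shortExact_syzygy (n : ℕ) :
    (ShortComplex.mk (resι p X n) (resπ p X n) (resι_resπ p X n)).ShortExact where
  exact := ShortComplex.exact_of_f_is_kernel _ (kernelIsKernel _)
  mono_f := inferInstanceAs (Mono (kernel.ι _))
  epi_g := inferInstanceAs (Epi (resπ p X n))

/-- The differential of the resolution. -/
def resD (n : ℕ) : resTerm p X (n + 1) ⟶ resTerm p X n := resπ p X (n + 1) ≫ resι p X n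

theorem resD_resπ (n : ℕ) : resD p X n ≫ resπ p X n = 0 := by
  rw [resD, Category.assoc, resι_resπ, comp_zero]

theorem resD_resD (n : ℕ) : resD p X (n + 1) ≫ resD p X n = 0 := by
  rw [resD.eq_1 p X n, ← Category.assoc, resD_resπ, zero_comp]

theorem exact_resD_resπ (n : ℕ) :
    (ShortComplex.mk (resD p X n) (resπ p X n) (resD_resπ p X n)).Exact := by
  let α : ShortComplex.mk (resD p X n) (resπ p X n) (resD_resπ p X n) ⟶
      ShortComplex.mk (resι p X n) (resπ p X n) (resι_resπ p X n) :=
    { τ₁ := resπ p X (n + 1)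
      τ₂ := 𝟙 _
      τ₃ := 𝟙 _
      comm₁₂ := (Category.comp_id _).symm }
  exact (ShortComplex.exact_iff_of_epi_of_isIso_of_mono α).2 (shortExact_syzygy p X n).exact

theorem exact_resD_resD (n : ℕ) :
    (ShortComplex.mk (resD p X (n + 1)) (resD p X n) (resD_resD p X n)).Exact := by
  let α : ShortComplex.mk (resD p X (n + 1)) (resπ p X (n + 1)) (resD_resπ p X (n + 1)) ⟶
      ShortComplex.mk (resD p X (n + 1)) (resD p X n) (resD_resD p X n) :=
    { τ₁ := 𝟙 _
      τ₂ := 𝟙 _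
      τ₃ := resι p X n
      comm₂₃ := Category.id_comp _ }
  have : Mono α.τ₃ := (shortExact_syzygy p X n).mono_f
  exact (ShortComplex.exact_iff_of_epi_of_isIso_of_mono α).1 (exact_resD_resπ p X (n + 1))

/-- The chain complex underlying the resolution. -/
def resComplex : ChainComplex A ℕ := ChainComplex.of (resTerm p X) (resD p X) (resD_resD p X)

theorem resComplex_d (n : ℕ) : (resComplex p X).d (n + 1) n = resD p X n :=
  ChainComplex.of_d _ _ _

theorem resComplex_exactAt_succ (n : ℕ) : (resComplex p X).ExactAt (n + 1) := by
  rw [HomologicalComplex.exactAt_iff' _ (n + 1 + 1) (n + 1) n (by simp) (by simp)]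
  refine (ShortComplex.exact_iff_of_iso ?_).2 (exact_resD_resD p X n)
  exact ShortComplex.isoMk (Iso.refl _) (Iso.refl _) (Iso.refl _)
    ((Category.id_comp _).trans ((resComplex_d p X _).symm.trans (Category.comp_id _).symm))
    ((Category.id_comp _).trans ((resComplex_d p X _).symm.trans (Category.comp_id _).symm))

theorem resComplex_d_resπ : (resComplex p X).d 1 0 ≫ resπ p X 0 = 0 := by
  rw [resComplex_d]
  exact resD_resπ p X 0

/-- The resolution of `X` by the projective covers `p`. -/
def resolution : ProjectiveResolution X where
  complex := resComplex p X
  projective n := (p (syzygy p X n)).projective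
  π := (ChainComplex.toSingle₀Equiv _ _).symm ⟨resπ p X 0, resComplex_d_resπ p X⟩
  quasiIso := ⟨fun n => by
    cases n
    · rw [ChainComplex.quasiIsoAt₀_iff, ShortComplex.quasiIso_iff_of_zeros' _ rfl rfl rfl]
      refine (ShortComplex.exact_and_epi_g_iff_of_iso ?_).2
        ⟨exact_resD_resπ p X 0, inferInstanceAs (Epi (resπ p X 0))⟩
      exact ShortComplex.isoMk (Iso.refl _) (Iso.refl _) (Iso.refl _)
        ((Category.id_comp _).trans ((resComplex_d p X _).symm.trans (Category.comp_id _).symm))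
        ((Category.id_comp _).trans ((ChainComplex.toSingle₀Equiv_symm_apply_f_zero
          (C := resComplex p X) (X := X) (resπ p X 0) (resComplex_d_resπ p X)).symm.trans
          (Category.comp_id _).symm))
    · rw [quasiIsoAt_iff_exactAt' _ _ (ChainComplex.exactAt_succ_single_obj _ _)]
      exact resComplex_exactAt_succ p X _⟩

end Resolution

section Tensor

variable {k : Type u} [CommRing k] {C : Type u} [SmallCategory C]

variable (k) in
/-- The class of a morphism in `kC / m`. -/
def algOf {y x : C} (f : y ⟶ x) : AlgQuot k y x :=
  algMk k y x (Finsupp.single f 1)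

theorem algOf_eq_zero {y x : C} (f : y ⟶ x) (h : y ≠ x) : algOf k f = 0 :=
  (Submodule.Quotient.mk_eq_zero _).2 (Submodule.subset_span ⟨⟨h, ⟨f⟩⟩, f, rfl⟩)

variable [GradedCategory C]

theorem rank_lt_of_objLT {x y : C} (h : ObjLT x y) : rank x < rank y := by
  let B : Set C := {z | ObjLT x z ∧ Nonempty (z ⟶ y)}
  have hB : B.Finite := by
    refine Set.Finite.subset ((Set.finite_Iic (rank y)).biUnion fun n _ =>
      GradedCategory.locallyBounded (C := C) n) ?_
    rintro z ⟨_, hz⟩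
    exact Set.mem_biUnion (rank_mono _ _ hz) rfl
  let P : PartialOrder C :=
    { le := fun a b => Nonempty (a ⟶ b)
      le_refl := fun a => ⟨𝟙 a⟩
      le_trans := fun a b c ⟨f⟩ ⟨g⟩ => ⟨f ≫ g⟩
      le_antisymm := fun a b => directed a b }
  obtain ⟨w, hw⟩ := hB.exists_minimal ⟨y, h, ⟨𝟙 y⟩⟩
  have hc : ObjCovers x w := by
    refine ⟨hw.1.1, fun z hxz hzw => hzw.1 ?_⟩
    obtain ⟨g⟩ := hw.1.2
    obtain ⟨f⟩ := hzw.2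
    exact directed _ _ ⟨f⟩ (hw.2 (y := z) ⟨hxz, ⟨f ≫ g⟩⟩ ⟨f⟩)
  have := rank_covers _ _ hc
  have := rank_mono _ _ hw.1.2
  omega

open Classical in
/-- The element `q ⊗ v` of `kC / m ⊗_{kC} V`. -/
def tmulAt (V : CMod k C) {y x : C} (q : AlgQuot k y x) (v : V.obj y) : TensorAt V x :=
  Submodule.Quotient.mk (DirectSum.lof k C (fun y => Summand V y x) y (q ⊗ₜ[k] v))

variable {V W : CMod k C}

theorem tmulAt_map {y' y x : C} (f : y' ⟶ y) (q : AlgQuot k y x) (v : V.obj y') :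
    tmulAt V q ((V.map f).hom v) = tmulAt V (quotRight k f x q) v := by
  refine ((Submodule.Quotient.eq _).2 ?_).symm
  rw [tensorRel]
  exact Submodule.subset_span ⟨y', y, f, q, v, rfl⟩

/-- The map `v ↦ 1 ⊗ v`. -/
def oneTmul (V : CMod k C) (x : C) : V.obj x →ₗ[k] TensorAt V x where
  toFun := tmulAt V (algOf k (𝟙 x))
  map_add' a b := by simp [tmulAt, TensorProduct.tmul_add]
  map_smul' a b := by simp [tmulAt, TensorProduct.tmul_smul]

theorem oneTmul_map_eq_tmulAt {y x : C} (f : y ⟶ x) (v : V.obj y) :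
    oneTmul V x ((V.map f).hom v) = tmulAt V (algOf k f) v := by
  refine (tmulAt_map f _ v).trans ?_
  rw [algOf, quotRight_mk, Category.comp_id]
  rfl

theorem oneTmul_map_of_ne {y x : C} (f : y ⟶ x) (h : y ≠ x) (v : V.obj y) :
    oneTmul V x ((V.map f).hom v) = 0 := by
  rw [oneTmul_map_eq_tmulAt, algOf_eq_zero f h]
  simp [tmulAt]

theorem oneTmul_map {y x : C} (f : y ⟶ x) (v : V.obj y) :
    oneTmul V x ((V.map f).hom v) = tensorLeft V f (oneTmul V y v) := by
  refine (oneTmul_map_eq_tmulAt f v).trans (Eq.trans ?_ (tensorLeft_mk V f y _ v).symm)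
  rw [algOf, algOf, quotLeft_mk, Category.id_comp, tmulAt]

theorem tensorMap_oneTmul (η : V ⟶ W) {x : C} (v : V.obj x) :
    tensorMap η x (oneTmul V x v) = oneTmul W x ((η.app x).hom v) :=
  tensorMap_mk η x _ v

theorem tensorAt_hom_eq_zero {x : C} {N : Type u} [AddCommGroup N] [Module k N]
    (φ : TensorAt V x →ₗ[k] N) (h : ∀ v, φ (oneTmul V x v) = 0) : φ = 0 := by
  classical
  refine tensorAt_ext fun y q v => ?_
  suffices H : φ ∘ₗ (tensorRel V x).mkQ ∘ₗ DirectSum.lof k C (fun y => Summand V y x) y ∘ₗ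
      (TensorProduct.mk k _ _).flip v = 0 from LinearMap.congr_fun H q
  refine algQuot_ext fun f => Eq.trans (congrArg φ ?_) (h ((V.map f).hom v))
  rw [oneTmul_map_eq_tmulAt, tmulAt]
  congr!

theorem subsingleton_tensorAt {x : C} (h : ∀ v, oneTmul V x v = 0) :
    Subsingleton (TensorAt V x) :=
  subsingleton_of_forall_eq 0 fun t =>
    LinearMap.congr_fun (tensorAt_hom_eq_zero LinearMap.id h) t

theorem tensorMap_surjective (η : V ⟶ W) [Epi η] (x : C) :
    Function.Surjective (tensorMap η x) := by
  rw [← LinearMap.range_eq_top, ← Submodule.ker_mkQ (LinearMap.range (tensorMap η x)),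
    LinearMap.ker_eq_top]
  refine tensorAt_hom_eq_zero _ fun w => ?_
  obtain ⟨v, rfl⟩ := (epi_iff_surjective η).1 inferInstance x w
  exact (Submodule.Quotient.mk_eq_zero _).2 ⟨oneTmul V x v, tensorMap_oneTmul η v⟩

section Lift

variable {x : C} {N : Type u} [AddCommGroup N] [Module k N] (φ : V.obj x →ₗ[k] N)
  (hφ : ∀ (y : C) (f : y ⟶ x), y ≠ x → ∀ v, φ ((V.map f).hom v) = 0)

/-- The pairing `(f, v) ↦ φ (f v)` of `(kC / m)(y, x)` and `V_y`, for a linear map `φ` on `V_x`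
that kills `m V`. -/
def quotPairing (y : C) : AlgQuot k y x →ₗ[k] V.obj y →ₗ[k] N :=
  (ideal k y x).liftQ (Finsupp.lift _ k _ fun f : y ⟶ x => φ ∘ₗ (V.map f).hom) (by
    refine Submodule.span_le.2 ?_
    rintro _ ⟨h, f, rfl⟩
    refine LinearMap.ext fun v => ?_
    simpa using hφ y f h.1 v)

omit [GradedCategory C] in
theorem quotPairing_algOf {y : C} (f : y ⟶ x) (v : V.obj y) :
    quotPairing φ hφ y (algOf k f) v = φ ((V.map f).hom v) := by
  change Finsupp.lift _ k _ (fun f : y ⟶ x => φ ∘ₗ (V.map f).hom) (Finsupp.single f 1) v = _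
  simp

theorem quotPairing_quotRight {y' y : C} (f : y' ⟶ y) (q : AlgQuot k y x) (v : V.obj y') :
    quotPairing φ hφ y' (quotRight k f x q) v = quotPairing φ hφ y q ((V.map f).hom v) := by
  suffices H : (quotPairing φ hφ y' ∘ₗ quotRight k f x).flip v =
      (quotPairing φ hφ y).flip ((V.map f).hom v) from LinearMap.congr_fun H q
  refine algQuot_ext fun g => ?_
  change quotPairing φ hφ y' (quotRight k f x (algMk k y x (Finsupp.single g 1))) v =
    quotPairing φ hφ y (algOf k g) ((V.map f).hom v)
  rw [quotRight_mk, quotPairing_algOf, ← ModuleCat.comp_apply, ← V.map_comp]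
  exact quotPairing_algOf φ hφ (f ≫ g) v

include hφ in
theorem exists_tensorAt_lift :
    ∃ ψ : TensorAt V x →ₗ[k] N, ∀ v, ψ (oneTmul V x v) = φ v := by
  classical
  refine ⟨(tensorRel V x).liftQ
    (DirectSum.toModule k C N fun y => TensorProduct.lift (quotPairing φ hφ y)) ?_, fun v => ?_⟩
  · refine Submodule.span_le.2 ?_
    rintro _ ⟨y', y, f, q, v, rfl⟩
    change DirectSum.toModule k C N _ _ = 0
    erw [map_sub, DirectSum.toModule_lof, DirectSum.toModule_lof]
    simp [quotPairing_quotRight]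
  · refine (Submodule.liftQ_apply _ _ _).trans ?_
    erw [DirectSum.toModule_lof]
    simp [quotPairing_algOf]

end Lift

theorem genLT_of_subsingleton_tensorAt {n : ℕ}
    (h : ∀ x, n ≤ rank x → Subsingleton (TensorAt V x)) : GenLT V n := by
  intro S hS f
  rw [hom_eq_zero_iff]
  intro x
  induction hm : rank x using Nat.strong_induction_on generalizing x with
  | _ m ih =>
    subst hm
    intro v
    rcases lt_or_ge (rank x) n with hx | hx
    · exact hS.eq_zero hx _
    · obtain ⟨ψ, hψ⟩ := exists_tensorAt_lift (f.app x).hom fun y g hy w => by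
        rw [app_map_apply, ih _ (rank_lt_of_objLT ⟨hy, ⟨g⟩⟩) y rfl w, map_zero]
      rw [← hψ, (h x hx).elim (oneTmul V x v) 0, map_zero]

theorem GenLT.subsingleton_tensorAt {n : ℕ} (h : GenLT V n) {x : C} (hx : n ≤ rank x) :
    Subsingleton (TensorAt V x) := by
  let N : SubMod V :=
    { carrier := fun y => ⨅ _ : n ≤ rank y, LinearMap.ker (oneTmul V y)
      map_mem := fun {y z} g v hv => by
        simp only [Submodule.mem_iInf, LinearMap.mem_ker] at hv ⊢
        intro hz
        rcases le_or_gt n (rank y) with hy | hy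
        · rw [oneTmul_map, hv hy, map_zero]
        · exact oneTmul_map_of_ne g (by rintro rfl; omega) v }
  have : Epi N.ι := h.epi _ fun y hy v =>
    ⟨⟨v, (Submodule.mem_iInf _).2 fun hy' => absurd hy (not_lt.2 hy')⟩, rfl⟩
  refine GradedCategory.subsingleton_tensorAt fun v => ?_
  obtain ⟨w, rfl⟩ := (epi_iff_surjective N.ι).1 inferInstance x v
  exact (Submodule.mem_iInf _).1 w.2 hx

end Tensor

section Regularity

variable {k : Type u} [CommRing k] {C : Type u} [SmallCategory C]

theorem isZero_homology_obj (K : ChainComplex (CMod k C) ℕ) (i : ℕ) (y : C)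
    (h : IsZero ((K.X i).obj y)) : IsZero ((K.homology i).obj y) := by
  have h₁ : IsZero ((K.cycles i).obj y) :=
    IsZero.of_mono (((evaluation C (ModuleCat.{u} k)).obj y).map (K.iCycles i)) h
  exact IsZero.of_epi (((evaluation C (ModuleCat.{u} k)).obj y).map (K.homologyπ i)) h₁

theorem app_eq_zero_of_isZero_homology (K : ChainComplex (CMod k C) ℕ) (i : ℕ) (y : C)
    (h : IsZero ((K.homology i).obj y)) (hd : ∀ j, (K.d i j).app y = 0) {Z : CMod k C}
    (q : K.X i ⟶ Z) (hq : ∀ j, K.d j i ≫ q = 0) : q.app y = 0 := by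
  have hex : ((K.sc i).map ((evaluation C (ModuleCat.{u} k)).obj y)).Exact := by
    rw [ShortComplex.exact_iff_isZero_homology]
    exact IsZero.of_iso h ((K.sc i).mapHomologyIso ((evaluation C (ModuleCat.{u} k)).obj y))
  rw [ShortComplex.moduleCat_exact_iff] at hex
  ext v
  obtain ⟨w, rfl⟩ := hex v (by
    change ((K.d i _).app y).hom v = 0
    rw [hd]
    rfl)
  exact (hom_eq_zero_iff _).1 (hq _) y w

variable [GradedCategory C]

/-- A projective presentation of `V` generated in the same ranks as `V`. -/
def cover (V : CMod k C) : ProjectivePresentation V := (exists_projectivePresentation V).choose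

theorem GenLT.cover {V : CMod k C} {n : ℕ} (h : GenLT V n) : GenLT (cover V).p n :=
  (exists_projectivePresentation V).choose_spec n h

variable (V : CMod k C)

/-- The complex `kC / m ⊗_{kC} P` for the resolution `P` of `V` by covers. -/
abbrev tensorRes : ChainComplex (CMod k C) ℕ :=
  ((tensorFunctor k C).mapHomologicalComplex _).obj (resolution cover V).complex

/-- The homology of `V` is computed by the resolution by covers. -/
def homologyIso (i : ℕ) : homology i V ≅ (tensorRes V).homology i :=
  (resolution cover V).isoLeftDerivedObj (tensorFunctor k C) i

variable {V}

theorem isZero_tensorFunctor_obj {n : ℕ} (h : GenLT V n) {y : C} (hy : n ≤ rank y) :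
    IsZero (((tensorFunctor k C).obj V).obj y) :=
  ModuleCat.isZero_iff_subsingleton.2 (h.subsingleton_tensorAt hy)

theorem ExtVanish.isZero_homology {c : ℕ} (h : ExtVanish V c) (i : ℕ) {y : C}
    (hy : c + i ≤ rank y) : IsZero ((homology i V).obj y) := by
  have hZ (j : ℕ) : ExtVanish (syzygy cover V j) (c + j) := by
    induction j with
    | zero => exact h
    | succ j ih =>
      have := (cover (syzygy cover V j)).projective
      exact ExtVanish.left (shortExact_syzygy cover V j)
        ((ExtVanish.of_projective ih.genLT.cover).mono (Nat.le_succ _)) ih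
  refine IsZero.of_iso (isZero_homology_obj (tensorRes V) i y ?_) ((homologyIso V i).app y)
  exact isZero_tensorFunctor_obj (V := resTerm cover V i) (hZ i).genLT.cover hy

theorem subsingleton_tensorAt_syzygy {j : ℕ} {y : C} (h : IsZero ((homology j V).obj y))
    (hj : ∀ i, i + 1 = j → IsZero (((tensorFunctor k C).obj (resTerm cover V i)).obj y)) :
    Subsingleton (TensorAt (syzygy cover V j) y) := by
  have h₀ : ((tensorFunctor k C).map (resπ cover V j)).app y = 0 := by
    refine app_eq_zero_of_isZero_homology (tensorRes V) j y
      (IsZero.of_iso h ((homologyIso V j).symm.app y)) (fun i => ?_) _ (fun i => ?_)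
    · by_cases hi : i + 1 = j
      · exact (hj i hi).eq_of_tgt _ _
      · rw [(tensorRes V).shape j i hi]
        rfl
    · by_cases hi : j + 1 = i
      · subst hi
        have hd : (tensorFunctor k C).map (resD cover V j) ≫
            (tensorFunctor k C).map (resπ cover V j) = 0 := by
          rw [← Functor.map_comp, resD_resπ, Functor.map_zero]
        rw [← resComplex_d] at hd
        exact hd
      · rw [(tensorRes V).shape i j hi]
        exact zero_comp
  refine subsingleton_of_forall_eq 0 fun t => ?_
  obtain ⟨s, rfl⟩ := tensorMap_surjective (resπ cover V j) y t
  exact LinearMap.congr_fun (congrArg ModuleCat.Hom.hom h₀) s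

theorem extVanish_of_isZero_homology {c : ℕ}
    (h : ∀ i y, c + i ≤ rank y → IsZero ((homology i V).obj y)) : ExtVanish V c := by
  have hZ (j : ℕ) : GenLT (syzygy cover V j) (c + j) := by
    induction j with
    | zero =>
      exact genLT_of_subsingleton_tensorAt fun y hy => subsingleton_tensorAt_syzygy (h 0 y hy)
        fun i hi => absurd hi (by omega)
    | succ j ih =>
      refine genLT_of_subsingleton_tensorAt fun y hy =>
        subsingleton_tensorAt_syzygy (h (j + 1) y hy) fun i hi => ?_
      obtain rfl : i = j := by omega
      exact isZero_tensorFunctor_obj (V := resTerm cover V i) ih.cover (by omega)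
  suffices H : ∀ (i j : ℕ) (S : CMod k C), VanishLT S (c + j + i) →
      ∀ e : Abelian.Ext (syzygy cover V j) S i, e = 0 from fun i S hS => H i 0 S hS
  intro i
  induction i with
  | zero => exact fun j S hS => (hZ j).ext_zero_eq_zero hS
  | succ i ih =>
    intro j S hS
    have := (cover (syzygy cover V j)).projective
    exact ext_succ_eq_zero (shortExact_syzygy cover V j) (ih (j + 1) S (hS.mono (by omega)))
      Abelian.Ext.eq_zero_of_projective

theorem ExtVanish.reg_lt_top {c : ℕ} (h : ExtVanish V c) : reg V < ⊤ := by
  refine lt_of_le_of_lt (iSup_le fun i => ?_) (lt_top_iff_ne_top.2 (EReal.natCast_ne_top c))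
  refine EReal.sub_le_of_le_add ?_
  have hci : ((c + i : ℕ) : EReal) = c + i := by norm_cast
  rw [← hci, hd]
  split_ifs with hz
  · exact (by norm_num : (-1 : EReal) ≤ 0).trans (by exact_mod_cast Nat.zero_le _)
  · refine iSup₂_le fun x hx => EReal.natCast_le_iff.2 ?_
    by_contra hlt
    exact hx (h.isZero_homology i (by omega))

theorem extVanish_of_reg_le {c : ℕ} (h : reg V ≤ c) : ExtVanish V (c + 1) := by
  refine extVanish_of_isZero_homology fun i y hy => ?_
  by_contra hz
  have h₁ : hd i V - i ≤ c := (le_iSup (fun i : ℕ => hd i V - (i : EReal)) i).trans h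
  have h₂ : (rank y : EReal) ≤ hd i V := by
    rw [hd, if_neg fun h0 => hz ((Functor.isZero_iff _).1 h0 y)]
    exact le_iSup₂ (f := fun (x : C) (_ : ¬ IsZero ((homology i V).obj x)) => (rank x : EReal)) y hz
  rw [EReal.sub_le_iff_le_add (Or.inl (EReal.natCast_ne_bot i))
    (Or.inl (EReal.natCast_ne_top i))] at h₁
  have h₃ : rank y ≤ c + i := EReal.natCast_le_iff.1 ((h₂.trans h₁).trans (by norm_cast))
  omega

end Regularity

section InductiveFunctor

variable {k : Type u} [CommRing k] {C : Type u} [SmallCategory C]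

variable (k C) in
/-- The inclusion of the `i`-th copy of `Id` into `Id^{⊕ d}`. -/
def idCopiesι {d : ℕ} (i : Fin d) : 𝟭 (CMod k C) ⟶ idCopies k C d where
  app V := biproduct.ι (fun _ : Fin d => V) i
  naturality _ _ f := (biproduct.ι_map (fun _ : Fin d => f) i).symm

variable [GradedCategory C]

namespace InductiveFunctor

variable {d : ℕ} (I : InductiveFunctor k C d)

instance : PreservesFiniteLimits I.F := I.preservesFiniteLimits

instance : PreservesFiniteColimits I.F := I.preservesFiniteColimits

/-- The `i`-th component `Id ⟶ F` of `θ`. -/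
def comp (i : Fin d) : 𝟭 (CMod k C) ⟶ I.F := idCopiesι k C i ≫ I.θ

theorem desc_comp_app (V : CMod k C) :
    biproduct.desc (f := fun _ : Fin d => V) (fun i => (I.comp i).app V) = I.θ.app V :=
  biproduct.hom_ext' _ _ fun _ => biproduct.ι_desc ..

theorem θ_app_comp_eq_zero_iff {V R : CMod k C} (q : I.F.obj V ⟶ R) :
    I.θ.app V ≫ q = 0 ↔ ∀ i, (I.comp i).app V ≫ q = 0 :=
  ⟨fun h _ => (Category.assoc ..).trans ((congrArg (_ ≫ ·) h).trans comp_zero),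
    fun h => biproduct.hom_ext' (f := fun _ : Fin d => V) _ _ fun i =>
      (Category.assoc ..).symm.trans ((h i).trans comp_zero.symm)⟩

variable {I} {V : CMod k C} {n : ℕ}

theorem genLT_cokernel_iff (hV : ¬ IsZero V) :
    GenLT (cokernel (I.θ.app V)) n ↔ GenLT V (n + 1) := by
  rw [← gd_lt_natCast_iff, ← gd_lt_natCast_iff, I.gd_cokernel V hV,
    EReal.sub_lt_iff (b := 1) (.inl (EReal.coe_ne_bot 1)) (.inl (EReal.coe_ne_top 1)),
    Nat.cast_succ]

theorem genLT_succ_of_quotientBy {l : List (Fin d)} (h : GenLT ((quotientBy I.comp l).obj V) n) :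
    GenLT V (n + 1) := by
  by_cases hV : IsZero V
  · exact .of_isZero hV _
  obtain ⟨r, hr⟩ := exists_quotientByπ_app_comp (θ := I.comp) (cokernel.π (I.θ.app V)) l
    fun i _ => (I.θ_app_comp_eq_zero_iff _).1 (cokernel.condition _) i
  have : Epi r := epi_of_epi_fac hr
  exact (genLT_cokernel_iff hV).1 (h.of_epi r)

theorem genLT_of_comp_app_comp_eq_zero (h : GenLT V (n + 1)) {R : CMod k C} (q : I.F.obj V ⟶ R)
    [Epi q] (hq : ∀ i, (I.comp i).app V ≫ q = 0) : GenLT R n := by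
  by_cases hV : IsZero V
  · exact (GenLT.of_isZero (I.F.map_isZero hV) n).of_epi q
  have hθ := (I.θ_app_comp_eq_zero_iff q).2 hq
  have : Epi (cokernel.desc _ q hθ) := epi_of_epi_fac (cokernel.π_desc _ q hθ)
  exact ((genLT_cokernel_iff hV).2 h).of_epi (cokernel.desc _ q hθ)

theorem isRegularOn_freeMod (x : C) {l : List (Fin d)} (hl : l.Nodup) :
    IsRegularOn I.comp (freeMod k x) l := by
  have : Mono (biproduct.desc (f := fun _ : Fin d => freeMod k x)
      fun i => (I.comp i).app (freeMod k x)) := by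
    rw [desc_comp_app]
    exact I.mono_free x
  exact .of_mono_desc hl

end InductiveFunctor

namespace IsFinFree

variable {d : ℕ} {I : InductiveFunctor k C d} {P : CMod k C} {n : ℕ}

variable (I) in
theorem isFG_map (h : IsFinFree n P) : IsFG (I.F.obj P) := by
  induction h with
  | zero => exact .of_isZero (I.F.map_isZero (isZero_zero _))
  | add x _ _ ih =>
    exact .of_shortExact ((shortExact_biprod _ _).map_of_exact I.F) ih (I.isFG_free x)

theorem isRegularOn (h : IsFinFree n P) {l : List (Fin d)} (hl : l.Nodup) :
    IsRegularOn I.comp P l := by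
  induction h with
  | zero => exact .of_isZero (isZero_zero _) l
  | add x _ _ ih => exact .of_shortExact (shortExact_biprod _ _) ih (I.isRegularOn_freeMod x hl)

variable (hF : ∀ x : C, ExtVanish (I.F.obj (freeMod k x)) (rank x + 1))
include hF

theorem extVanish_map (h : IsFinFree n P) : ExtVanish (I.F.obj P) n := by
  induction h with
  | zero => exact .of_isZero (I.F.map_isZero (isZero_zero _)) n
  | add x hx _ ih =>
    exact .middle ((shortExact_biprod _ _).map_of_exact I.F) ih ((hF x).mono hx)

theorem extVanish_quotientBy (h : IsFinFree n P) {l : List (Fin d)} (hl : l.Nodup) :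
    ExtVanish ((quotientBy I.comp l).obj P) n := by
  induction l with
  | nil => exact h.extVanish_map hF
  | cons i l ih =>
    have := h.projective
    exact .right (h.isRegularOn hl).shortExact_induced (.of_projective h.genLT) (ih hl.of_cons)

end IsFinFree

namespace InductiveFunctor

variable {d : ℕ} {I : InductiveFunctor k C d} {V : CMod k C}
  (hF : ∀ x : C, ExtVanish (I.F.obj (freeMod k x)) (rank x + 1))
  (hN : LocallyNoetherian k C)

include hF hN

/- The syzygy of `V` again satisfies the hypotheses, with `c + 1` in place of `c`. -/
theorem ext_eq_zero_of_isRegularOn {l : List (Fin d)} (hl : l.Nodup) (i : ℕ) {c : ℕ}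
    (hV : IsFG V) (hreg : IsRegularOn I.comp V l)
    (h : ExtVanish ((quotientBy I.comp l).obj V) c) {S : CMod k C}
    (hS : VanishLT S (c + 1 + i)) (e : Abelian.Ext V S i) : e = 0 := by
  have hgen : GenLT V (c + 1) := genLT_succ_of_quotientBy h.genLT
  induction i generalizing V c with
  | zero => exact hgen.ext_zero_eq_zero hS e
  | succ i ih =>
    obtain ⟨P, f, hP, _⟩ := hV.exists_isFinFree hN hgen
    have := hP.projective
    have hK : (ShortComplex.mk (kernel.ι f) f (kernel.condition f)).ShortExact :=
      { exact := ShortComplex.exact_of_f_is_kernel _ (kernelIsKernel f) }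
    have hQ : ExtVanish ((quotientBy I.comp l).obj (kernel f)) (c + 1) :=
      .left (hreg.shortExact_map hK) (hP.extVanish_quotientBy hF hl) h
    refine ext_succ_eq_zero hK (fun e => ?_) Abelian.Ext.eq_zero_of_projective e
    exact ih (hN P hP.isFG _ (kernel.ι f)) (.of_mono (kernel.ι f) (hP.isRegularOn hl)) hQ
      (hS.mono (by omega)) e (genLT_succ_of_quotientBy hQ.genLT)

theorem exists_extVanish (hV : IsFG V) : ∃ c, ExtVanish V c := by
  obtain ⟨n, hn⟩ := hV.exists_genLT
  induction n generalizing V with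
  | zero => exact ⟨0, .of_isZero (hn.isZero_of_vanishLT fun _ hx => absurd hx (by simp)) 0⟩
  | succ n ihn =>
    refine hV.induction_on_quotients hN (𝒬 := fun W => GenLT W (n + 1) → ∃ c, ExtVanish W c)
      (fun W hW ih hgen => ?_) hn
    by_cases hW₀ : IsZero W
    · exact ⟨0, .of_isZero hW₀ 0⟩
    obtain ⟨l, hreg, hmax⟩ :=
      IsRegularOn.exists_forall_not_mono (θ := I.comp) hW₀ Finset.univ
    obtain ⟨P, f, hP, _⟩ := hW.exists_isFinFree hN hgen
    have hFW : IsFG (I.F.obj W) := (hP.isFG_map I).of_epi (I.F.map f)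
    obtain ⟨c, hc⟩ : ∃ c, ExtVanish ((quotientBy I.comp l).obj W) c := by
      refine prop_of_forall_not_mono (𝒬 := fun W => ∃ c, ExtVanish W c)
        (fun U e _ he => ih U e he (hgen.of_epi e)) Finset.univ
        (fun i => (induced I.comp l i).app W) hmax fun R q _ hq => ?_
      refine ihn (hFW.of_epi ((quotientByπ I.comp l).app W ≫ q))
        (genLT_of_comp_app_comp_eq_zero hgen ((quotientByπ I.comp l).app W ≫ q) fun i => ?_)
      exact (Category.assoc ..).symm.trans (hq i (Finset.mem_univ i))
    exact ⟨c + 1, fun i S hS e =>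
      ext_eq_zero_of_isRegularOn hF hN (hreg.nodup hW₀) i hW hreg hc hS e⟩

end InductiveFunctor

end InductiveFunctor

end

end GradedCategory

theorem theorem1p2 (k : Type u) [CommRing k] [IsNoetherianRing k]
    (C : Type u) [SmallCategory C] [GradedCategory C]
    (d : ℕ) (I : GradedCategory.InductiveFunctor k C d)
    (hN : GradedCategory.LocallyNoetherian k C)
    (hreg : ∀ x : C,
      GradedCategory.reg (I.F.obj (GradedCategory.freeMod k x)) ≤ (GradedCategory.rank x : EReal))
    (V : GradedCategory.CMod k C) (hV : GradedCategory.IsFG V) :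
    GradedCategory.reg V < ⊤ := by
  obtain ⟨c, hc⟩ := GradedCategory.InductiveFunctor.exists_extVanish
    (fun x => GradedCategory.extVanish_of_reg_le (hreg x)) hN hV
  exact hc.reg_lt_top
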